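/- Let $X$ be a finite abstract simplicial complex and let $H_k(X)$ denote its simplicial homology with integer coefficients. For $d\ge 2$, $X$ is called a $d$-dimensional $\mathbb{Q}$-acyclic complex if $X$ has dimension $d$, $X$ has complete $(d-1)$-skeleton (every non-empty set of at most $d$ vertices of $X$ is a face of $X$), $H_d(X)=0$, and $H_{d-1}(X)$ is finite. Corollary. For every $d\ge 2$ there is a constant $C_d$ such that for every nontrivial finite abelian group $G$ there is a $d$-dimensional $\mathbb{Q}$-acyclic complex $X$ on at most $C_d(\log|G|)^{1/d}$ vertices such that $G$ is isomorphic to a subgroup of $H_{d-1}(X)$. -/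

import Mathlib

namespace SimplicialHomology

universe u

variable {V : Type u} [LinearOrder V]

/-- The `k`-dimensional faces of `X`: the faces with exactly `k + 1` vertices. -/
abbrev Face (X : AbstractSimplicialComplex V) (k : ℕ) : Type u :=
  {s : Finset V // s ∈ X.faces ∧ s.card = k + 1}

/-- The face of `s` obtained by deleting the vertex `v`. -/
def Face.erase {X : AbstractSimplicialComplex V} {k : ℕ} (s : Face X (k + 1)) (v : V)
    (hv : v ∈ s.1) : Face X k :=
  ⟨s.1.erase v, by
    have hc : (s.1.erase v).card = k + 1 := by
      rw [Finset.card_erase_of_mem hv, s.2.2]; rfl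
    exact ⟨(X.isRelLowerSet_faces s.2.1).2 (Finset.erase_subset v s.1)
      (Finset.card_pos.1 (by omega)), hc⟩⟩

/-- The position of `v` in `s`, counted from `0` in increasing order of the vertices. -/
def pos (s : Finset V) (v : V) : ℕ := (s.filter (· < v)).card

/-- Simplicial `k`-chains with integer coefficients. Every face carries the orientation
given by the order of the vertices. -/
abbrev Chains (X : AbstractSimplicialComplex V) (k : ℕ) : Type u := Face X k →₀ ℤ

/-- The boundary map `∂ [v₀, …, v_{k+1}] = ∑ i, (-1)^i [v₀, …, v̂ᵢ, …, v_{k+1}]`. -/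
noncomputable def boundary (X : AbstractSimplicialComplex V) (k : ℕ) :
    Chains X (k + 1) →ₗ[ℤ] Chains X k :=
  Finsupp.linearCombination ℤ fun s : Face X (k + 1) =>
    ∑ v ∈ s.1.attach, (-1 : ℤ) ^ pos s.1 v.1 • Finsupp.single (s.erase v.1 v.2) (1 : ℤ)

/-- The `k`-cycles. Every `0`-chain is a cycle (homology is not reduced). -/
noncomputable def cycles (X : AbstractSimplicialComplex V) : (k : ℕ) → Submodule ℤ (Chains X k)
  | 0 => ⊤
  | k + 1 => LinearMap.ker (boundary X k)

/-- The `k`-boundaries. -/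
noncomputable def boundaries (X : AbstractSimplicialComplex V) (k : ℕ) :
    Submodule ℤ (Chains X k) :=
  LinearMap.range (boundary X k)


theorem boundary_comp_boundary (X : AbstractSimplicialComplex V) (k : ℕ) :
    boundary X k ∘ₗ boundary X (k + 1) = 0 := by
  refine Finsupp.lhom_ext' fun s => LinearMap.ext_ring ?_
  simp only [boundary, LinearMap.comp_apply, Finsupp.lsingle_apply,
    Finsupp.linearCombination_single, map_sum, map_smul, LinearMap.zero_apply,
    Finset.smul_sum, smul_smul, one_mul]
  rw [Finset.sum_sigma']
  refine Finset.sum_involution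
    (fun x _ => ⟨⟨x.2.1, Finset.mem_of_mem_erase x.2.2⟩,
      ⟨x.1.1, Finset.mem_erase.2 ⟨fun h => Finset.ne_of_mem_erase x.2.2 h.symm, x.1.2⟩⟩⟩)
    ?_ ?_ ?_ ?_
  · rintro ⟨⟨v, hv⟩, ⟨w, hw⟩⟩ -
    have hwv : w ≠ v := Finset.ne_of_mem_erase hw
    have hws : w ∈ s.1 := Finset.mem_of_mem_erase hw
    have key : ∀ a b : V, a ∈ s.1 → b ∈ s.1 → a < b →
        pos s.1 b = pos (s.1.erase a) b + 1 ∧ pos (s.1.erase b) a = pos s.1 a := by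
      intro a b ha hb hab
      unfold pos
      rw [Finset.filter_erase, Finset.filter_erase]
      constructor
      · rw [Finset.card_erase_add_one]
        simp [ha, hab]
      · rw [Finset.erase_eq_of_notMem]
        simp [hab.le]
    have hface : Face.erase (Face.erase s v hv) w hw
        = Face.erase (Face.erase s w hws)
          v (Finset.mem_erase.2 ⟨fun h => Finset.ne_of_mem_erase hw h.symm, hv⟩) :=
      Subtype.ext (Finset.erase_right_comm)
    dsimp only
    rw [hface, ← add_smul]
    convert zero_smul ℤ _
    change (-1 : ℤ) ^ pos s.1 v * (-1) ^ pos (s.1.erase v) w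
      + (-1) ^ pos s.1 w * (-1) ^ pos (s.1.erase w) v = 0
    rcases lt_or_gt_of_ne hwv with h | h
    · obtain ⟨h1, h2⟩ := key w v hws hv h
      rw [h1, h2]; ring
    · obtain ⟨h1, h2⟩ := key v w hv hws h
      rw [h1, h2]; ring
  · rintro ⟨⟨v, hv⟩, ⟨w, hw⟩⟩ - - h
    have : w = v := congrArg (fun x => x.1.1) h
    exact Finset.ne_of_mem_erase hw this
  · intros; simp
  · rintro ⟨⟨v, hv⟩, ⟨w, hw⟩⟩ -
    rfl

/-- Boundaries are cycles. -/
theorem boundaries_le_cycles (X : AbstractSimplicialComplex V) (k : ℕ) :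
    boundaries X k ≤ cycles X k := by
  cases k with
  | zero => exact le_top
  | succ k => exact LinearMap.range_le_ker_iff.2 (boundary_comp_boundary X k)

/-- The `k`-th simplicial homology group with integer coefficients, cycles modulo boundaries. -/
abbrev Homology (X : AbstractSimplicialComplex V) (k : ℕ) : Type u :=
  cycles X k ⧸ (boundaries X k).comap (cycles X k).subtype

/-- `X` is `d`-dimensional: the largest faces have exactly `d + 1` vertices. -/
def HasDimension (X : AbstractSimplicialComplex V) (d : ℕ) : Prop :=
  (∀ s ∈ X.faces, s.card ≤ d + 1) ∧ ∃ s ∈ X.faces, s.card = d + 1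

/-- A `d`-dimensional `ℚ`-acyclic complex (for `d ≥ 2`): a `d`-dimensional complex with complete
`(d - 1)`-skeleton, with `H_d(X) = 0` and with `H_{d-1}(X)` finite. -/
structure IsQAcyclic (X : AbstractSimplicialComplex V) (d : ℕ) : Prop where
  hasDimension : HasDimension X d
  complete_skeleton : ∀ s : Finset V, s.Nonempty → s.card ≤ d → s ∈ X.faces
  top_homology : Subsingleton (Homology X d)
  finite_homology : Finite (Homology X (d - 1))

end SimplicialHomology

/-! Write `d = j + 2`. Adding to the complete `(d-1)`-skeleton a maximal set `I` of `d`-simplices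
with independent boundaries gives a `ℚ`-acyclic complex: independence kills `H_d`, while coning a
cycle and maximality make `H_{d-1}` torsion. Let `I` extend a maximal independent part of a family
`F`. A `G`-valued cochain that kills `∂F` and maps the saturation of the span of `∂F` onto `G` then
exhibits `G` as a quotient of a subgroup of `H_{d-1}`, hence, by duality, as a subgroup
(`exists_isQAcyclic_of_cochain`). It remains to encode `G` by such data on few vertices.

With vertices in `d + 1` colours, `d`-faces become points and `(d-1)`-faces lines of a grid `α ^ (d
+ 1)`. Lines in direction `0` are points of `α ^ d` and carry a function `g`; the other lines of a
slice can be labelled so as to realise any vanishing alternating sum of `g` over a cube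
(`exists_lines_of_cubes`). Cubes without a common line share a slice, so `O(n)` slices hold about `n
^ d` cubes (`eq_of_cubeSlice_eq`).

For a cyclic summand of order `N`, double-and-add computes `N • x` in `O(log N)` steps, each costing
a bounded number of cubes at one of `n ^ d` addresses. The cube relations force a nonzero multiple
of the generator's chain to be a boundary (`accumulator_eq`). All of `G` takes `O(log |G|)`
addresses, so `n` of order `(log |G|)^(1/d)` suffices. -/

/-! ### Maximal independent families and duality of finite abelian groups -/

/-- An independent subfamily of `t` extends to one that is maximal in `t`. -/
theorem LinearIndepOn.exists_maximal_extension {R M ι : Type*} [CommRing R] [AddCommGroup M]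
    [Module R M] [Finite ι] (v : ι → M) {s t : Set ι} (hst : s ⊆ t) (hs : LinearIndepOn R v s) :
    ∃ I : Set ι, s ⊆ I ∧ I ⊆ t ∧ LinearIndepOn R v I ∧
      ∀ i ∈ t, i ∉ I → ∃ a : R, a ≠ 0 ∧ a • v i ∈ Submodule.span R (v '' I) := by
  classical
  obtain ⟨I, hI⟩ := (Set.toFinite {I : Set ι | s ⊆ I ∧ I ⊆ t ∧ LinearIndepOn R v I}).exists_maximal
    ⟨s, subset_rfl, hst, hs⟩
  refine ⟨I, hI.prop.1, hI.prop.2.1, hI.prop.2.2, fun i hit hiI => ?_⟩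
  have hdep : ¬ LinearIndepOn R v (insert i I) := fun h =>
    hiI (hI.le_of_ge ⟨hI.prop.1.trans (Set.subset_insert _ _),
      Set.insert_subset hit hI.prop.2.1, h⟩ (Set.subset_insert _ _) (Set.mem_insert _ _))
  obtain ⟨f, hf, hf0, hfne⟩ := linearDepOn_iff'.1 hdep
  have hsupp : f.erase i ∈ Finsupp.supported R R I := by
    intro x hx
    rw [Finset.mem_coe, Finsupp.support_erase, Finset.mem_erase] at hx
    exact (hf hx.2).resolve_left hx.1
  have hfi : f i ≠ 0 := by
    intro h0
    refine hfne (linearIndepOn_iff.1 hI.prop.2.2 f ?_ hf0)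
    rwa [Finsupp.erase_of_notMem_support (by simpa using h0)] at hsupp
  refine ⟨f i, hfi, ?_⟩
  rw [← Finsupp.single_add_erase i f, map_add, Finsupp.linearCombination_single] at hf0
  rw [eq_neg_of_add_eq_zero_left hf0]
  exact Submodule.neg_mem _ (Finsupp.mem_span_image_iff_linearCombination R |>.2 ⟨_, hsupp, rfl⟩)

/-- A surjection of finite abelian groups `K → G` yields an embedding `G → K`. -/
theorem AddMonoidHom.exists_injective_of_surjective {K G : Type*} [AddCommGroup K] [AddCommGroup G]
    [Finite K] (f : K →+ G) (hf : Function.Surjective f) :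
    ∃ g : G →+ K, Function.Injective g := by
  have : Finite G := Finite.of_surjective f hf
  -- A finite abelian group is non-canonically its own character group, and pulling characters back
  -- along a surjection is injective.
  obtain ⟨eG⟩ := CommGroup.monoidHom_mulEquiv_of_hasEnoughRootsOfUnity (Multiplicative G) ℂ
  obtain ⟨eK⟩ := CommGroup.monoidHom_mulEquiv_of_hasEnoughRootsOfUnity (Multiplicative K) ℂ
  let r : (Multiplicative G →* ℂˣ) →* (Multiplicative K →* ℂˣ) :=
    MonoidHom.compHom' (AddMonoidHom.toMultiplicative f)
  have hr : Function.Injective r := fun a b h => by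
    ext x
    obtain ⟨y, hy⟩ := hf x
    have := DFunLike.congr_fun h (Multiplicative.ofAdd y)
    simpa [r, hy] using congrArg Units.val this
  let g : Multiplicative G →* Multiplicative K :=
    (eK.toMonoidHom.comp r).comp eG.symm.toMonoidHom
  refine ⟨MonoidHom.toAdditive g, ?_⟩
  have : Function.Injective g := eK.injective.comp (hr.comp eG.symm.injective)
  exact this

/-- `f` factors through the subgroup `q.range` of `H`, so `G` is a quotient of a subgroup of `H`;
duality turns the quotient into a subgroup. -/
theorem AddMonoidHom.exists_injective_of_ker_le {S H G : Type*} [AddCommGroup S] [AddCommGroup H]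
    [AddCommGroup G] [Finite H] (q : S →+ H) (f : S →+ G) (hf : Function.Surjective f)
    (hqf : q.ker ≤ f.ker) : ∃ g : G →+ H, Function.Injective g := by
  let e : q.range →+ G :=
    (QuotientAddGroup.lift q.ker f hqf).comp
      (QuotientAddGroup.quotientKerEquivRange q).symm.toAddMonoidHom
  have he : Function.Surjective e := by
    intro x
    obtain ⟨y, rfl⟩ := hf x
    refine ⟨QuotientAddGroup.quotientKerEquivRange q (QuotientAddGroup.mk y), ?_⟩
    simp [e]
  obtain ⟨g, hg⟩ := e.exists_injective_of_surjective he
  exact ⟨q.range.subtype.comp g, Subtype.val_injective.comp hg⟩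

namespace SimplicialHomology

/-! ### Chains on finite vertex sets and the cone contraction -/

section FinsetChains

variable {V : Type*}

/-- Chains of a complex regarded as chains of finite vertex sets. -/
noncomputable def Chains.toFinset (X : AbstractSimplicialComplex V) (k : ℕ) :
    Chains X k →ₗ[ℤ] (Finset V →₀ ℤ) :=
  Finsupp.lmapDomain ℤ ℤ Subtype.val

theorem Chains.toFinset_injective (X : AbstractSimplicialComplex V) (k : ℕ) :
    Function.Injective (Chains.toFinset X k) :=
  Finsupp.mapDomain_injective Subtype.val_injective

theorem Chains.toFinset_single (X : AbstractSimplicialComplex V) (k : ℕ) (s : Face X k) (a : ℤ) :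
    Chains.toFinset X k (Finsupp.single s a) = Finsupp.single s.1 a := by
  simp [Chains.toFinset]

theorem Chains.range_toFinset (X : AbstractSimplicialComplex V) (k : ℕ) :
    LinearMap.range (Chains.toFinset X k) =
      Finsupp.supported ℤ ℤ {s | s ∈ X.faces ∧ s.card = k + 1} := by
  rw [Chains.toFinset, Finsupp.range_lmapDomain, Finsupp.supported_eq_span_single,
    Set.image_eq_range]
  rfl

variable [LinearOrder V]

/-- The boundary of a single oriented simplex, as a chain of finite vertex sets. -/
noncomputable def simplexBoundary (s : Finset V) : Finset V →₀ ℤ :=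
  ∑ v ∈ s, Finsupp.single (s.erase v) ((-1 : ℤ) ^ pos s v)

/-- The simplicial boundary on chains of arbitrary finite vertex sets. -/
noncomputable def finsetBoundary : (Finset V →₀ ℤ) →ₗ[ℤ] (Finset V →₀ ℤ) :=
  Finsupp.linearCombination ℤ simplexBoundary

@[simp] theorem finsetBoundary_single (s : Finset V) (a : ℤ) :
    finsetBoundary (Finsupp.single s a) = a • simplexBoundary s := by
  simp [finsetBoundary]

theorem Chains.toFinset_boundary (X : AbstractSimplicialComplex V) (k : ℕ)
    (c : Chains X (k + 1)) :
    Chains.toFinset X k (boundary X k c) = finsetBoundary (Chains.toFinset X (k + 1) c) := by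
  have : Chains.toFinset X k ∘ₗ boundary X k = finsetBoundary ∘ₗ Chains.toFinset X (k + 1) := by
    refine Finsupp.lhom_ext' fun s => LinearMap.ext_ring ?_
    simp only [boundary, LinearMap.comp_apply, Finsupp.lsingle_apply,
      Finsupp.linearCombination_single, map_sum, map_smul, Chains.toFinset_single,
      finsetBoundary_single, one_smul, simplexBoundary]
    rw [← Finset.sum_attach s.1]
    refine Finset.sum_congr rfl fun v _ => ?_
    simp [Face.erase]
  exact LinearMap.congr_fun this c

theorem map_boundaries (X : AbstractSimplicialComplex V) (k : ℕ) :
    (boundaries X k).map (Chains.toFinset X k) =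
      Submodule.span ℤ (simplexBoundary '' {s | s ∈ X.faces ∧ s.card = k + 1 + 1}) := by
  have : Chains.toFinset X k ∘ₗ boundary X k = finsetBoundary ∘ₗ Chains.toFinset X (k + 1) :=
    LinearMap.ext (Chains.toFinset_boundary X k)
  rw [boundaries, ← LinearMap.range_comp, this, LinearMap.range_comp, Chains.range_toFinset,
    Finsupp.span_image_eq_map_linearCombination, finsetBoundary]

theorem simplexBoundary_ne_zero {s : Finset V} (hs : s.Nonempty) : simplexBoundary s ≠ 0 := by
  obtain ⟨v, hv⟩ := hs
  intro h
  have h1 := DFunLike.congr_fun h (s.erase v)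
  rw [simplexBoundary, Finsupp.finsetSum_apply, Finset.sum_eq_single_of_mem v hv] at h1
  · simp at h1
  · intro w hw hwv
    refine Finsupp.single_eq_of_ne fun h => ?_
    have : v ∈ s.erase w := Finset.mem_erase.2 ⟨hwv.symm, hv⟩
    rw [← h] at this
    simp at this

/-- The cone operator with apex `v₀`. -/
noncomputable def cone (v₀ : V) : (Finset V →₀ ℤ) →ₗ[ℤ] (Finset V →₀ ℤ) :=
  Finsupp.linearCombination ℤ fun s =>
    if v₀ ∈ s then 0 else Finsupp.single (insert v₀ s) (1 : ℤ)

/-- The least vertex has position `0` in every simplex, and adding it shifts the other positions by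
one. The empty set counts as a simplex, so no correction is needed in low degree. -/
theorem finsetBoundary_cone [OrderBot V] (c : Finset V →₀ ℤ) :
    finsetBoundary (cone ⊥ c) + cone ⊥ (finsetBoundary c) = c := by
  have : finsetBoundary ∘ₗ cone (⊥ : V) + cone ⊥ ∘ₗ finsetBoundary = LinearMap.id := by
    refine Finsupp.lhom_ext' fun s => LinearMap.ext_ring ?_
    simp only [LinearMap.add_apply, LinearMap.comp_apply, Finsupp.lsingle_apply,
      finsetBoundary_single, one_smul, LinearMap.id_apply, simplexBoundary, map_sum, cone,
      Finsupp.linearCombination_single]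
    have hpos : ∀ t : Finset V, pos t ⊥ = 0 := fun t => by simp [pos]
    by_cases h : ⊥ ∈ s
    · rw [if_pos h, map_zero, zero_add, Finset.sum_eq_single_of_mem ⊥ h]
      · simp [hpos, Finset.insert_erase h]
      · intro v hv hv0
        rw [if_pos (Finset.mem_erase.2 ⟨hv0.symm, h⟩), smul_zero]
    · rw [if_neg h, finsetBoundary_single, one_smul, simplexBoundary, Finset.sum_insert h, hpos,
        pow_zero, Finset.erase_insert h, add_assoc, ← Finset.sum_add_distrib,
        Finset.sum_eq_zero, add_zero]
      intro v hv
      have hv0 : v ≠ ⊥ := fun h' => h (h' ▸ hv)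
      have hp : pos (insert ⊥ s) v = pos s v + 1 := by
        rw [pos, Finset.filter_insert, if_pos (bot_lt_iff_ne_bot.2 hv0),
          Finset.card_insert_of_notMem (by simp [h]), pos]
      rw [if_neg (by simp [h]), hp, Finset.erase_insert_of_ne hv0.symm, Finsupp.smul_single,
        ← Finsupp.single_add]
      simp [pow_succ]
  exact LinearMap.congr_fun this c

theorem cone_mem_supported {v₀ : V} {k : ℕ} {c : Finset V →₀ ℤ}
    (hc : c ∈ Finsupp.supported ℤ ℤ {s : Finset V | s.card = k}) :
    cone v₀ c ∈ Finsupp.supported ℤ ℤ {s : Finset V | s.card = k + 1} := by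
  rw [cone, Finsupp.linearCombination_apply]
  refine Submodule.sum_mem _ fun s hs => Submodule.smul_mem _ _ ?_
  split_ifs with h
  · exact Submodule.zero_mem _
  · refine Finsupp.single_mem_supported ℤ _ ?_
    have : s.card = k := hc hs
    simp [Finset.card_insert_of_notMem h, this]

end FinsetChains

/-! ### Acyclic complexes from maximal independent sets of simplices -/

/-- The complex with complete `d`-skeleton on `V` and set of `(d + 1)`-faces `I`. -/
def skeletonUnion {V : Type*} [LinearOrder V] (d : ℕ) (I : Set (Finset V))
    (hI : ∀ s ∈ I, s.card = d + 2) :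
    AbstractSimplicialComplex V where
  faces := {s | s.Nonempty ∧ (s.card ≤ d + 1 ∨ s ∈ I)}
  isRelLowerSet_faces := by
    rintro s ⟨hs, hs'⟩
    refine ⟨hs, fun t hts ht => ⟨ht, ?_⟩⟩
    by_cases h : t = s
    · subst h; exact hs'
    · have := Finset.card_lt_card (Finset.ssubset_iff_subset_ne.2 ⟨hts, h⟩)
      rcases hs' with h' | h'
      · exact Or.inl (by omega)
      · have := hI s h'
        exact Or.inl (by omega)
  singleton_mem v := ⟨by simp, Or.inl (by simp)⟩

/-- If multiples of the elements of `S` lie in a submodule, then so do multiples of the elements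
of the span of `S`. -/
theorem exists_smul_mem_of_mem_span {M : Type*} [AddCommGroup M] {S : Set M} {B : Submodule ℤ M}
    (h : ∀ x ∈ S, ∃ a : ℤ, a ≠ 0 ∧ a • x ∈ B) {x : M} (hx : x ∈ Submodule.span ℤ S) :
    ∃ a : ℤ, a ≠ 0 ∧ a • x ∈ B := by
  induction hx using Submodule.span_induction with
  | mem x hx => exact h x hx
  | zero => exact ⟨1, one_ne_zero, by simp⟩
  | add x y _ _ hx hy =>
    obtain ⟨a, ha, hax⟩ := hx
    obtain ⟨b, hb, hby⟩ := hy
    refine ⟨a * b, mul_ne_zero ha hb, ?_⟩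
    rw [smul_add, mul_comm a b, mul_smul, mul_comm b a, mul_smul]
    exact B.add_mem (B.smul_mem _ hax) (B.smul_mem _ hby)
  | smul c x _ hx =>
    obtain ⟨a, ha, hax⟩ := hx
    exact ⟨a, ha, by rw [smul_comm]; exact B.smul_mem _ hax⟩

/-- Coordinates in an independent family are unique, so a coordinate outside `s` is killed by `m ≠
0` and vanishes. -/
theorem mem_span_of_smul_mem_of_linearIndepOn {M ι : Type*} [AddCommGroup M]
    {v : ι → M} {s t : Set ι} (ht : LinearIndepOn ℤ v t) (hst : s ⊆ t) {x : M}
    (hx : x ∈ Submodule.span ℤ (v '' t)) {m : ℤ} (hm : m ≠ 0)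
    (hmx : m • x ∈ Submodule.span ℤ (v '' s)) : x ∈ Submodule.span ℤ (v '' s) := by
  rw [Finsupp.mem_span_image_iff_linearCombination] at hx hmx ⊢
  obtain ⟨f, hf, rfl⟩ := hx
  obtain ⟨g, hg, hgf⟩ := hmx
  have h0 := linearIndepOn_iff.1 ht (g - m • f)
    (Submodule.sub_mem _ (Finsupp.supported_mono hst hg) (Submodule.smul_mem _ _ hf))
    (by rw [map_sub, hgf, map_smul, sub_self])
  refine ⟨f, fun i hi => hg ?_, rfl⟩
  rw [sub_eq_zero.1 h0]
  simpa [hm] using hi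

variable {N j : ℕ}

section

variable {I : Set (Finset (Fin N))} (hI : ∀ s ∈ I, s.card = j + 1 + 2)
include hI

theorem skeletonUnion_faces_top :
    {s | s ∈ (skeletonUnion (j + 1) I hI).faces ∧ s.card = j + 1 + 1 + 1} = I := by
  ext s
  constructor
  · rintro ⟨⟨_, h | h⟩, h'⟩
    · omega
    · exact h
  · intro h
    have := hI s h
    exact ⟨⟨Finset.card_pos.1 (by omega), Or.inr h⟩, by omega⟩

theorem skeletonUnion_faces_ridge :
    {s | s ∈ (skeletonUnion (j + 1) I hI).faces ∧ s.card = j + 1 + 1} =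
      {s | s.card = j + 2} := by
  ext s
  constructor
  · exact fun h => h.2
  · intro h
    have h : s.card = j + 2 := h
    exact ⟨⟨Finset.card_pos.1 (by omega), Or.inl (by omega)⟩, by omega⟩

theorem mem_boundaries_skeletonUnion (c : Chains (skeletonUnion (j + 1) I hI) (j + 1)) :
    c ∈ boundaries (skeletonUnion (j + 1) I hI) (j + 1) ↔
      Chains.toFinset _ _ c ∈ Submodule.span ℤ (simplexBoundary '' I) := by
  have h := map_boundaries (skeletonUnion (j + 1) I hI) (j + 1)
  rw [skeletonUnion_faces_top hI] at h
  rw [← h, Submodule.mem_map]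
  constructor
  · exact fun hc => ⟨c, hc, rfl⟩
  · rintro ⟨c', hc', h⟩
    rwa [← Chains.toFinset_injective _ _ h]

theorem subsingleton_homology_skeletonUnion (hind : LinearIndepOn ℤ simplexBoundary I) :
    Subsingleton (Homology (skeletonUnion (j + 1) I hI) (j + 2)) := by
  set X := skeletonUnion (j + 1) I hI
  have hker : cycles X (j + 2) = ⊥ := by
    refine (Submodule.eq_bot_iff _).2 fun c hc => ?_
    have hc : boundary X (j + 1) c = 0 := hc
    refine Chains.toFinset_injective X (j + 2) ?_
    rw [map_zero]
    refine linearIndepOn_iff.1 hind _ ?_ ?_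
    · have : Chains.toFinset X (j + 2) c ∈ LinearMap.range (Chains.toFinset X (j + 2)) := ⟨c, rfl⟩
      rw [Chains.range_toFinset] at this
      rwa [show {s | s ∈ X.faces ∧ s.card = j + 2 + 1} = I from skeletonUnion_faces_top hI] at this
    · change finsetBoundary _ = 0
      rw [← Chains.toFinset_boundary, hc, map_zero]
  have : Subsingleton (cycles X (j + 2)) := by rw [hker]; infer_instance
  exact (Submodule.mkQ_surjective _).subsingleton

/-- A cycle is the boundary of its cone, hence a combination of boundaries of arbitrary
`d`-simplices, each of which has a multiple in the span of `∂I`. -/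
theorem exists_smul_mem_boundaries (hN : 0 < N)
    (hmax : ∀ s : Finset (Fin N), s.card = j + 3 →
      ∃ a : ℤ, a ≠ 0 ∧ a • simplexBoundary s ∈ Submodule.span ℤ (simplexBoundary '' I))
    (c : Chains (skeletonUnion (j + 1) I hI) (j + 1))
    (hc : c ∈ cycles (skeletonUnion (j + 1) I hI) (j + 1)) :
    ∃ m : ℤ, m ≠ 0 ∧ m • c ∈ boundaries (skeletonUnion (j + 1) I hI) (j + 1) := by
  have : NeZero N := ⟨hN.ne'⟩
  let X := skeletonUnion (j + 1) I hI
  have hc : boundary X j c = 0 := hc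
  have hcone := finsetBoundary_cone (Chains.toFinset X (j + 1) c)
  rw [← Chains.toFinset_boundary, hc, map_zero, map_zero, add_zero] at hcone
  have hs : Chains.toFinset X (j + 1) c ∈ Finsupp.supported ℤ ℤ {s | s.card = j + 2} := by
    have h : Chains.toFinset X (j + 1) c ∈ LinearMap.range (Chains.toFinset X (j + 1)) := ⟨c, rfl⟩
    rwa [Chains.range_toFinset, skeletonUnion_faces_ridge hI] at h
  have hspan : Chains.toFinset X (j + 1) c ∈
      Submodule.span ℤ (simplexBoundary '' {s : Finset (Fin N) | s.card = j + 3}) := by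
    rw [← hcone, Finsupp.mem_span_image_iff_linearCombination]
    exact ⟨_, cone_mem_supported hs, rfl⟩
  obtain ⟨m, hm, hmc⟩ := exists_smul_mem_of_mem_span
    (B := Submodule.span ℤ (simplexBoundary '' I))
    (by rintro _ ⟨s, hs, rfl⟩; exact hmax s hs) hspan
  refine ⟨m, hm, ?_⟩
  rwa [mem_boundaries_skeletonUnion, map_smul]

end

theorem finite_homology_of_smul_mem (X : AbstractSimplicialComplex (Fin N)) (k : ℕ)
    (h : ∀ c ∈ cycles X k, ∃ m : ℤ, m ≠ 0 ∧ m • c ∈ boundaries X k) :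
    Finite (Homology X k) := by
  have : Finite (Face X k) := inferInstance
  have : Module.Finite ℤ (Homology X k) := inferInstance
  refine Module.finite_of_fg_torsion _ ?_
  intro x
  obtain ⟨⟨c, hc⟩, rfl⟩ := Submodule.mkQ_surjective _ x
  obtain ⟨m, hm, hmc⟩ := h c hc
  refine ⟨⟨m, mem_nonZeroDivisors_of_ne_zero hm⟩, ?_⟩
  change m • Submodule.mkQ ((boundaries X k).comap (cycles X k).subtype) ⟨c, hc⟩ = 0
  rw [← map_smul, Submodule.mkQ_apply, Submodule.Quotient.mk_eq_zero]
  exact hmc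

/-- A family `F` of `d`-simplices and a `G`-valued `(d - 1)`-cochain that vanishes on the boundaries
of `F` and is onto on the saturation of these boundaries give a `ℚ`-acyclic complex whose homology
contains `G`. -/
theorem exists_isQAcyclic_of_cochain {G : Type*} [AddCommGroup G] (hN : j + 3 ≤ N)
    (F : Set (Finset (Fin N))) (hF : ∀ s ∈ F, s.card = j + 3)
    (φ : (Finset (Fin N) →₀ ℤ) →ₗ[ℤ] G) (hφ : ∀ s ∈ F, φ (simplexBoundary s) = 0)
    (hsurj : ∀ x : G, ∃ z ∈ Finsupp.supported ℤ ℤ {s : Finset (Fin N) | s.card = j + 2}, φ z = x ∧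
      ∃ m : ℤ, m ≠ 0 ∧ m • z ∈ Submodule.span ℤ (simplexBoundary '' F)) :
    ∃ X : AbstractSimplicialComplex (Fin N), IsQAcyclic X (j + 2) ∧
      ∃ f : G →+ Homology X (j + 1), Function.Injective f := by
  -- The basis is chosen inside `F` first, so that the saturation of `∂F` is already that of `∂I₀`.
  obtain ⟨I₀, -, hI₀F, hI₀, hmax₀⟩ := LinearIndepOn.exists_maximal_extension (R := ℤ)
    (simplexBoundary (V := Fin N)) (Set.empty_subset F) (linearIndepOn_empty _ _)
  obtain ⟨I, hI₀I, hIt, hI, hmax⟩ := LinearIndepOn.exists_maximal_extension (R := ℤ)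
    (simplexBoundary (V := Fin N)) (t := {s | s.card = j + 3}) (hI₀F.trans hF) hI₀
  have hmax' : ∀ s : Finset (Fin N), s.card = j + 3 →
      ∃ a : ℤ, a ≠ 0 ∧ a • simplexBoundary s ∈ Submodule.span ℤ (simplexBoundary '' I) := by
    intro s hs
    by_cases h : s ∈ I
    · exact ⟨1, one_ne_zero, by
        rw [one_smul]; exact Submodule.subset_span (Set.mem_image_of_mem _ h)⟩
    · exact hmax s hs h
  have hmax₀' : ∀ x ∈ simplexBoundary '' F,
      ∃ a : ℤ, a ≠ 0 ∧ a • x ∈ Submodule.span ℤ (simplexBoundary '' I₀) := by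
    rintro _ ⟨s, hs, rfl⟩
    by_cases h : s ∈ I₀
    · exact ⟨1, one_ne_zero, by
        rw [one_smul]; exact Submodule.subset_span (Set.mem_image_of_mem _ h)⟩
    · exact hmax₀ s hs h
  have hIt : ∀ s ∈ I, s.card = j + 1 + 2 := hIt
  let X := skeletonUnion (j + 1) I hIt
  have hsmul := exists_smul_mem_boundaries hIt (by omega) hmax'
  have hfin : Finite (Homology X (j + 1)) := finite_homology_of_smul_mem X (j + 1) hsmul
  refine ⟨X, ⟨⟨?_, ?_⟩, ?_, subsingleton_homology_skeletonUnion hIt hI, hfin⟩, ?_⟩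
  · rintro s ⟨_, h | h⟩
    · omega
    · exact (hIt s h).le
  · have hIne : I.Nonempty := by
      by_contra hne
      rw [Set.not_nonempty_iff_eq_empty] at hne
      obtain ⟨s, -, hs⟩ := Finset.exists_subset_card_eq (s := (Finset.univ : Finset (Fin N)))
        (n := j + 3) (by simpa using hN)
      obtain ⟨a, ha, has⟩ := hmax' s hs
      rw [hne, Set.image_empty, Submodule.span_empty, Submodule.mem_bot, smul_eq_zero] at has
      exact has.elim ha (simplexBoundary_ne_zero (Finset.card_pos.1 (by omega)))
    obtain ⟨s, hs⟩ := hIne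
    have := hIt s hs
    exact ⟨s, ⟨Finset.card_pos.1 (by omega), Or.inr hs⟩, this⟩
  · exact fun s hs hc => ⟨hs, Or.inl hc⟩
  · let B₀ : Submodule ℤ (Finset (Fin N) →₀ ℤ) := Submodule.span ℤ (simplexBoundary '' I₀)
    -- `S` is the saturation of `∂I₀` in the cycles; `q` maps it to homology and `f` evaluates the
    -- cochain on it.
    let S : AddSubgroup (cycles X (j + 1)) :=
      { carrier := {c | ∃ m : ℤ, m ≠ 0 ∧ m • Chains.toFinset X (j + 1) c.1 ∈ B₀}
        zero_mem' := ⟨1, one_ne_zero, by simp⟩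
        add_mem' := by
          rintro a b ⟨m, hm, hma⟩ ⟨n, hn, hnb⟩
          refine ⟨m * n, mul_ne_zero hm hn, ?_⟩
          rw [Submodule.coe_add, map_add, smul_add, mul_comm m n, mul_smul, mul_comm n m, mul_smul]
          exact B₀.add_mem (B₀.smul_mem _ hma) (B₀.smul_mem _ hnb)
        neg_mem' := by
          rintro a ⟨m, hm, hma⟩
          refine ⟨m, hm, ?_⟩
          rw [Submodule.coe_neg, map_neg, smul_neg]
          exact B₀.neg_mem hma }
    let q : S →+ Homology X (j + 1) := (Submodule.mkQ _).toAddMonoidHom.comp S.subtype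
    let f : S →+ G := ((φ ∘ₗ Chains.toFinset X (j + 1)).toAddMonoidHom.comp
      (cycles X (j + 1)).subtype.toAddMonoidHom).comp S.subtype
    have hB₀φ : ∀ z ∈ B₀, φ z = 0 := by
      intro z hz
      have : B₀ ≤ LinearMap.ker φ := Submodule.span_le.2 (by
        rintro _ ⟨s, hs, rfl⟩
        exact hφ s (hI₀F hs))
      exact this hz
    refine AddMonoidHom.exists_injective_of_ker_le q f ?_ ?_
    · intro x
      obtain ⟨z, hz, rfl, m, hm, hmz⟩ := hsurj x
      obtain ⟨a, ha, haz⟩ := exists_smul_mem_of_mem_span hmax₀' hmz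
      rw [← mul_smul] at haz
      rw [← skeletonUnion_faces_ridge hIt, ← Chains.range_toFinset] at hz
      obtain ⟨c, rfl⟩ := hz
      have hmc : (a * m) • c ∈ boundaries X (j + 1) := by
        rw [mem_boundaries_skeletonUnion, map_smul]
        exact Submodule.span_mono (Set.image_mono hI₀I) haz
      -- Chains are torsion-free: if a nonzero multiple of `c` is a cycle, so is `c`.
      have hcyc : boundary X j ((a * m) • c) = 0 := boundaries_le_cycles X (j + 1) hmc
      rw [map_smul, smul_eq_zero_iff_right (mul_ne_zero ha hm)] at hcyc
      exact ⟨⟨⟨c, hcyc⟩, a * m, mul_ne_zero ha hm, haz⟩, rfl⟩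
    · rintro ⟨⟨c, hc⟩, m, hm, hmc⟩ hq
      have hcB : c ∈ boundaries X (j + 1) :=
        (Submodule.Quotient.mk_eq_zero ((boundaries X (j + 1)).comap
          (cycles X (j + 1)).subtype)).1 (AddMonoidHom.mem_ker.1 hq)
      rw [mem_boundaries_skeletonUnion] at hcB
      -- An element of `S` that bounds in `X` lies in the span of `∂I₀` itself, not just in its
      -- saturation, and there `φ` vanishes.
      exact hB₀φ _ (mem_span_of_smul_mem_of_linearIndepOn hI hI₀I hcB hm hmc)

/-! ### Coloured vertices: faces as points and lines of a grid -/

theorem simplexBoundary_image {V : Type*} [LinearOrder V] {d : ℕ} {f : Fin (d + 1) → V}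
    (hf : StrictMono f) :
    simplexBoundary (Finset.univ.image f) =
      ∑ i : Fin (d + 1), Finsupp.single (Finset.univ.image fun k : Fin d => f (i.succAbove k)) ((-1 : ℤ) ^ (i : ℕ)) := by
  rw [simplexBoundary, Finset.sum_image hf.injective.injOn]
  refine Finset.sum_congr rfl fun i _ => ?_
  have h1 : pos (Finset.univ.image f) (f i) = i := by
    have : (Finset.univ.image f).filter (· < f i) = (Finset.Iio i).image f := by
      ext x
      simp only [Finset.mem_filter, Finset.mem_image, Finset.mem_univ, true_and, Finset.mem_Iio]
      constructor
      · rintro ⟨⟨k, rfl⟩, hk⟩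
        exact ⟨k, hf.lt_iff_lt.1 hk, rfl⟩
      · rintro ⟨k, hk, rfl⟩
        exact ⟨⟨k, rfl⟩, hf hk⟩
    rw [pos, this, Finset.card_image_of_injective _ hf.injective, Fin.card_Iio]
  have h2 : (Finset.univ.image f).erase (f i) =
      Finset.univ.image fun k => f (i.succAbove k) := by
    ext x
    simp only [Finset.mem_erase, Finset.mem_image, Finset.mem_univ, true_and]
    constructor
    · rintro ⟨hx, k, rfl⟩
      obtain ⟨l, rfl⟩ := Fin.exists_succAbove_eq (x := k) (y := i) fun h => hx (by rw [h])
      exact ⟨l, rfl⟩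
    · rintro ⟨k, rfl⟩
      exact ⟨fun h => Fin.succAbove_ne i k (hf.injective h), _, rfl⟩
  rw [h1, h2]

section Grid

variable {α : Type*} {d : ℕ}

/-- The axis-parallel lines of the grid `α ^ (d + 1)`: a direction and a point of the quotient. -/
abbrev GridLine (α : Type*) (d : ℕ) : Type _ := Fin (d + 1) × (Fin d → α)

/-- The sum of the `d + 1` lines through a grid point. -/
noncomputable def linesThrough (p : Fin (d + 1) → α) : GridLine α d →₀ ℤ :=
  ∑ i, Finsupp.single (i, i.removeNth p) 1

variable [Fintype α]

/-- The vertex of `Fin ((d + 1) * |α|)` with colour `i` and value `x`. -/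
noncomputable def gridVertex (i : Fin (d + 1)) (x : α) : Fin ((d + 1) * Fintype.card α) :=
  finProdFinEquiv (i, Fintype.equivFin α x)

theorem gridVertex_inj {i i' : Fin (d + 1)} {x x' : α} :
    gridVertex i x = gridVertex i' x' ↔ i = i' ∧ x = x' := by
  simp [gridVertex]

/-- The colour is the leading digit of the vertex number, so incidence signs depend only on the
omitted colour. -/
theorem gridVertex_strictMono (p : Fin (d + 1) → α) :
    StrictMono fun i => gridVertex i (p i) := by
  intro i i' h
  simp only [gridVertex, Fin.lt_def, finProdFinEquiv_apply_val]
  have h1 := (Fintype.equivFin α (p i)).isLt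
  have h2 : (i : ℕ) + 1 ≤ i' := h
  calc _ < Fintype.card α * ((i : ℕ) + 1) := by rw [mul_add, mul_one]; omega
    _ ≤ Fintype.card α * i' := Nat.mul_le_mul_left _ h2
    _ ≤ _ := Nat.le_add_left _ _

/-- The `(d - 1)`-face of a grid line. -/
noncomputable def lineFace (l : GridLine α d) : Finset (Fin ((d + 1) * Fintype.card α)) :=
  Finset.univ.image fun k => gridVertex (l.1.succAbove k) (l.2 k)

/-- The `d`-face of a grid point. -/
noncomputable def pointFace (p : Fin (d + 1) → α) : Finset (Fin ((d + 1) * Fintype.card α)) :=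
  Finset.univ.image fun i => gridVertex i (p i)

theorem lineFace_injective : Function.Injective (lineFace (α := α) (d := d)) := by
  rintro ⟨i, q⟩ ⟨i', q'⟩ h
  have key : ∀ k, ∃ k', i'.succAbove k' = i.succAbove k ∧ q' k' = q k := by
    intro k
    have : gridVertex (i.succAbove k) (q k) ∈ lineFace (i', q') := by
      rw [← h]; exact Finset.mem_image_of_mem _ (Finset.mem_univ k)
    obtain ⟨k', -, hk'⟩ := Finset.mem_image.1 this
    exact ⟨k', gridVertex_inj.1 hk'⟩
  have hi : i = i' := by
    by_contra hne
    obtain ⟨k, hk⟩ := Fin.exists_succAbove_eq (x := i') (y := i) (Ne.symm hne)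
    obtain ⟨k', hk', -⟩ := key k
    exact Fin.succAbove_ne i' k' (hk'.trans hk)
  subst hi
  refine Prod.ext rfl (funext fun k => ?_)
  obtain ⟨k', hk', hq⟩ := key k
  rw [Fin.succAbove_right_injective hk'] at hq
  exact hq.symm

theorem card_lineFace (l : GridLine α d) : (lineFace l).card = d := by
  rw [lineFace, Finset.card_image_of_injective, Finset.card_univ, Fintype.card_fin]
  intro k k' h
  exact Fin.succAbove_right_injective (gridVertex_inj.1 h).1

theorem card_pointFace (p : Fin (d + 1) → α) : (pointFace p).card = d + 1 := by
  rw [pointFace, Finset.card_image_of_injective _ (gridVertex_strictMono p).injective,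
    Finset.card_univ, Fintype.card_fin]

/-- Formal sums of lines as simplicial chains. -/
noncomputable def lineChain : (GridLine α d →₀ ℤ) →ₗ[ℤ]
    (Finset (Fin ((d + 1) * Fintype.card α)) →₀ ℤ) :=
  Finsupp.linearCombination ℤ fun l : GridLine α d => Finsupp.single (lineFace l) ((-1 : ℤ) ^ (l.1 : ℕ))

theorem lineChain_linesThrough (p : Fin (d + 1) → α) :
    lineChain (linesThrough p) = simplexBoundary (pointFace p) := by
  rw [pointFace, simplexBoundary_image (gridVertex_strictMono p), linesThrough, map_sum]
  refine Finset.sum_congr rfl fun i _ => ?_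
  rw [lineChain, Finsupp.linearCombination_single, one_smul]
  rfl

end Grid

/-- A `G`-valued function on the lines of a grid and a set `P` of points through which the lines
sum to zero give a `ℚ`-acyclic complex. -/
theorem exists_isQAcyclic_of_grid {α : Type*} [Fintype α] [Nonempty α] {G : Type*} [AddCommGroup G]
    {j : ℕ} (P : Set (Fin (j + 3) → α)) (ψ : GridLine α (j + 2) → G)
    (hψ : ∀ p ∈ P, ∑ i, ψ (i, i.removeNth p) = 0)
    (hsurj : ∀ x : G, ∃ z, Finsupp.linearCombination ℤ ψ z = x ∧
      ∃ m : ℤ, m ≠ 0 ∧ m • z ∈ Submodule.span ℤ (linesThrough '' P)) :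
    ∃ X : AbstractSimplicialComplex (Fin ((j + 3) * Fintype.card α)), IsQAcyclic X (j + 2) ∧
      ∃ f : G →+ Homology X (j + 1), Function.Injective f := by
  have hcard : 0 < Fintype.card α := Fintype.card_pos
  -- The sign cancels the one in `lineChain`; faces that are not lines get the value `0`.
  let φ : (Finset (Fin ((j + 3) * Fintype.card α)) →₀ ℤ) →ₗ[ℤ] G :=
    Finsupp.linearCombination ℤ
      (Function.extend lineFace (fun l => (-1 : ℤ) ^ (l.1 : ℕ) • ψ l) 0)
  have hφ : ∀ z, φ (lineChain z) = Finsupp.linearCombination ℤ ψ z := by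
    intro z
    have : φ ∘ₗ lineChain = Finsupp.linearCombination ℤ ψ := by
      refine Finsupp.lhom_ext' fun l => LinearMap.ext_ring ?_
      simp only [φ, lineChain, LinearMap.comp_apply, Finsupp.lsingle_apply,
        Finsupp.linearCombination_single, one_smul, lineFace_injective.extend_apply, smul_smul,
        ← mul_pow]
      simp
    exact LinearMap.congr_fun this z
  refine exists_isQAcyclic_of_cochain (Nat.le_mul_of_pos_right _ hcard) (pointFace '' P) ?_ φ ?_ ?_
  · rintro _ ⟨p, -, rfl⟩
    exact card_pointFace p
  · rintro _ ⟨p, hp, rfl⟩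
    rw [← lineChain_linesThrough, hφ, linesThrough, map_sum, ← hψ p hp]
    simp
  · intro x
    obtain ⟨z, rfl, m, hm, hmz⟩ := hsurj x
    refine ⟨lineChain z, ?_, hφ z, m, hm, ?_⟩
    · rw [lineChain, Finsupp.linearCombination_apply]
      exact Submodule.sum_mem _ fun l _ => Submodule.smul_mem _ _
        (Finsupp.single_mem_supported ℤ _ (card_lineFace l))
    · rw [← map_smul]
      have := Submodule.mem_map_of_mem (f := lineChain) hmz
      rwa [Submodule.map_span, ← Set.image_comp, show lineChain ∘ linesThrough (α := α) (d := j + 2)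
        = simplexBoundary ∘ pointFace from funext lineChain_linesThrough, Set.image_comp] at this

/-! ### Alternating sums over cubes and their realisation in slices -/

section Cubes

variable {α G : Type*} [AddCommGroup G] {d : ℕ}

/-- The corner of the cube with opposite corners `lo` and `hi` selected by `ε`. -/
def corner (lo hi : Fin d → α) (ε : Fin d → Bool) : Fin d → α :=
  fun i => if ε i then hi i else lo i

/-- The sign of a corner. -/
def cornerSign (ε : Fin d → Bool) : ℤ := ∏ i, if ε i then -1 else 1

/-- The alternating sum of a function over the corners of a cube. -/
def alternatingSum (lo hi : Fin d → α) (f : (Fin d → α) → G) : G :=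
  ∑ ε, cornerSign ε • f (corner lo hi ε)

theorem alternatingSum_eq_zero_of_indep (lo hi : Fin d → α) {f : (Fin d → α) → G} (i : Fin d)
    (hf : ∀ v x, f (Function.update v i x) = f v) : alternatingSum lo hi f = 0 := by
  refine Finset.sum_involution (fun ε _ => Function.update ε i (!ε i)) ?_ ?_ ?_ ?_
  · intro ε _
    have h1 : cornerSign (Function.update ε i (!ε i)) = - cornerSign ε := by
      rw [cornerSign, cornerSign, ← Finset.mul_prod_erase _ _ (Finset.mem_univ i),
        ← Finset.mul_prod_erase Finset.univ (fun j => if ε j then (-1 : ℤ) else 1)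
          (Finset.mem_univ i), ← neg_mul]
      congr 1
      · rw [Function.update_self]; cases ε i <;> simp
      · refine Finset.prod_congr rfl fun j hj => ?_
        rw [Function.update_of_ne (Finset.ne_of_mem_erase hj)]
    have h2 : corner lo hi (Function.update ε i (!ε i)) =
        Function.update (corner lo hi ε) i (if !ε i then hi i else lo i) := by
      ext j
      by_cases hj : j = i
      · subst hj; simp [corner]
      · simp [corner, hj]
    rw [h1, h2, hf, neg_smul, add_neg_cancel]
  · intro ε _ _ h
    have := congrFun h i
    simp at this
  · intros; exact Finset.mem_univ _
  · intro ε _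
    simp

theorem alternatingSum_add (lo hi : Fin d → α) (f g : (Fin d → α) → G) :
    alternatingSum lo hi (fun v => f v + g v) =
      alternatingSum lo hi f + alternatingSum lo hi g := by
  simp [alternatingSum, smul_add, Finset.sum_add_distrib]

theorem alternatingSum_sum {ι : Type*} (s : Finset ι) (lo hi : Fin d → α)
    (f : ι → (Fin d → α) → G) :
    alternatingSum lo hi (fun v => ∑ i ∈ s, f i v) = ∑ i ∈ s, alternatingSum lo hi (f i) := by
  simp only [alternatingSum, Finset.smul_sum]
  exact Finset.sum_comm

theorem map_alternatingSum {G' : Type*} [AddCommGroup G'] (φ : G →+ G') (lo hi : Fin d → α)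
    (f : (Fin d → α) → G) :
    φ (alternatingSum lo hi f) = alternatingSum lo hi fun v => φ (f v) := by
  simp [alternatingSum]

/-- Induction on the hyperplanes `v i = hi i`. The new summand is the current error projected to the
new hyperplane; it vanishes on the old ones, since the projection preserves them. -/
theorem exists_indep_sum_of_mem (hi : Fin d → α) (f : (Fin d → α) → G) (s : Finset (Fin d)) :
    ∃ H : Fin d → (Fin d → α) → G, (∀ i v x, H i (Function.update v i x) = H i v) ∧
      ∀ v, (∃ i ∈ s, v i = hi i) → f v = ∑ i ∈ s, H i v := by
  induction s using Finset.induction_on with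
  | empty => exact ⟨fun _ _ => 0, by simp, by simp⟩
  | insert a s ha ih =>
    obtain ⟨H, hH, hf⟩ := ih
    refine ⟨Function.update H a fun v => f (Function.update v a (hi a)) -
      ∑ i ∈ s, H i (Function.update v a (hi a)), ?_, ?_⟩
    · intro i v x
      by_cases hi : i = a
      · subst hi; simp
      · simp [hi, hH]
    · intro v hv
      have hs : ∑ i ∈ s, Function.update H a (fun v => f (Function.update v a (hi a)) -
          ∑ i ∈ s, H i (Function.update v a (hi a))) i v = ∑ i ∈ s, H i v := by
        refine Finset.sum_congr rfl fun i hi => ?_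
        rw [Function.update_of_ne (ne_of_mem_of_not_mem hi ha)]
      rw [Finset.sum_insert ha, hs, Function.update_self]
      by_cases hva : v a = hi a
      · rw [← hva, Function.update_eq_self]; abel
      · obtain ⟨i, his, hvi⟩ := hv
        have hia : i ≠ a := fun h => hva (h ▸ hvi)
        have his : i ∈ s := (Finset.mem_insert.1 his).resolve_left hia
        rw [← hf _ ⟨i, his, by rwa [Function.update_of_ne hia]⟩, sub_self, zero_add]
        exact hf v ⟨i, his, hvi⟩

/-- A function with vanishing alternating sum over a cube is, on this cube, a sum of functions each
of which does not depend on one of the coordinates. -/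
theorem exists_indep_sum {lo hi : Fin d → α} {f : (Fin d → α) → G}
    (h : alternatingSum lo hi f = 0) :
    ∃ H : Fin d → (Fin d → α) → G, (∀ i v x, H i (Function.update v i x) = H i v) ∧
      ∀ ε, f (corner lo hi ε) = ∑ i, H i (corner lo hi ε) := by
  obtain ⟨H, hH, hf⟩ := exists_indep_sum_of_mem hi f Finset.univ
  have hne : ∀ ε : Fin d → Bool, ε ≠ (fun _ => false) →
      f (corner lo hi ε) = ∑ i, H i (corner lo hi ε) := by
    intro ε hε
    obtain ⟨i, hi'⟩ := Function.ne_iff.1 hε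
    exact hf _ ⟨i, Finset.mem_univ i, by simp [corner, Bool.eq_true_of_not_eq_false hi']⟩
  refine ⟨H, hH, fun ε => ?_⟩
  by_cases hε : ε = fun _ => false
  -- Both sides have vanishing alternating sum and agree at every other corner, so they agree at the
  -- all-`lo` corner too.
  · have h0 : alternatingSum lo hi (fun v => ∑ i, H i v) = 0 := by
      rw [alternatingSum_sum]
      exact Finset.sum_eq_zero fun i _ => alternatingSum_eq_zero_of_indep lo hi i (hH i)
    rw [← h0, alternatingSum, alternatingSum, ← sub_eq_zero, ← Finset.sum_sub_distrib,
      Finset.sum_eq_single_of_mem ε (Finset.mem_univ _), ← smul_sub] at h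
    · rw [hε] at h ⊢
      simpa [cornerSign, sub_eq_zero] using h
    · intro ε' _ hε'
      rw [hne ε' (hε ▸ hε'), sub_self]
  · exact hne ε hε

theorem linesThrough_cons {e : ℕ} (t : α) (v : Fin (e + 1) → α) :
    linesThrough (Fin.cons t v : Fin (e + 2) → α) = Finsupp.single (0, v) 1 +
      ∑ i : Fin (e + 1), Finsupp.single (i.succ, Fin.cons t (i.removeNth v)) 1 := by
  rw [linesThrough, Fin.sum_univ_succ]
  congr 1
  exact Finset.sum_congr rfl fun i _ => by rw [← Fin.cons_comp_succ_succAbove]; rfl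

/-- A line in another direction forgets a coordinate of `v`, so it cancels. The result is
independent of `t`, which carries relations from one slice to another. -/
theorem alternatingSum_linesThrough_cons {e : ℕ} (t : α) (lo hi : Fin (e + 1) → α) :
    alternatingSum lo hi (fun v => linesThrough (Fin.cons t v : Fin (e + 2) → α)) =
      alternatingSum lo hi fun v => Finsupp.single ((0, v) : GridLine α (e + 1)) (1 : ℤ) := by
  simp only [linesThrough_cons]
  rw [alternatingSum_add, alternatingSum_sum, Finset.sum_eq_zero, add_zero]
  exact fun i _ => alternatingSum_eq_zero_of_indep lo hi i fun v x => by rw [Fin.removeNth_update]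

/-- A function `g` on a grid whose alternating sum vanishes on a family of cubes, distributed over
slices such that cubes in the same slice have no line in common, comes from a function on the
lines of a grid of one dimension more. The relations enforced there comprise the cube relations
and the vanishing of `g`. -/
theorem exists_lines_of_cubes {e : ℕ} {ι : Type*} (g : (Fin (e + 1) → α) → G) (star : α)
    (lo hi : ι → Fin (e + 1) → α) (slice : ι → α) (hstar : ∀ a, slice a ≠ star)
    (hdisj : ∀ a b (i : Fin (e + 1)) ε ε', slice a = slice b →
      i.removeNth (corner (lo a) (hi a) ε) = i.removeNth (corner (lo b) (hi b) ε') → a = b)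
    (hg : ∀ a, alternatingSum (lo a) (hi a) g = 0) :
    ∃ (P : Set (Fin (e + 2) → α)) (ψ : GridLine α (e + 1) → G),
      (∀ p ∈ P, ∑ i, ψ (i, i.removeNth p) = 0) ∧
      ∃ E : (Fin (e + 1) → α) →
          (GridLine α (e + 1) →₀ ℤ) ⧸ Submodule.span ℤ (linesThrough '' P),
        (∀ v, g v = 0 → E v = 0) ∧ (∀ a, alternatingSum (lo a) (hi a) E = 0) ∧
        ∀ v, ∃ z, Submodule.Quotient.mk z = E v ∧ Finsupp.linearCombination ℤ ψ z = g v := by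
  classical
  choose H hH hHg using fun a => exists_indep_sum (hg a)
  let hits (t : α) (i : Fin (e + 1)) (q : Fin e → α) (a : ι) : Prop :=
    slice a = t ∧ ∃ ε, q = i.removeNth (corner (lo a) (hi a) ε)
  -- By `hdisj` at most one cube of the slice meets a given line, so the choice is forced; the
  -- inserted coordinate is irrelevant to `H _ i`.
  let h (t : α) (i : Fin (e + 1)) (q : Fin e → α) : G :=
    if hq : ∃ a, hits t i q a then
      -H hq.choose i (i.insertNth (lo hq.choose i) q) else 0
  let ψ (l : GridLine α (e + 1)) : G :=
    Fin.cases (g l.2) (fun i => h (l.2 0) i (Fin.tail l.2)) l.1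
  have hh : ∀ a i ε, h (slice a) i (i.removeNth (corner (lo a) (hi a) ε)) =
      -H a i (corner (lo a) (hi a) ε) := by
    intro a i ε
    have hq : ∃ b, hits (slice a) i (i.removeNth (corner (lo a) (hi a) ε)) b := ⟨a, rfl, ε, rfl⟩
    have hb : hq.choose = a := by
      obtain ⟨h1, ε', h2⟩ := hq.choose_spec
      exact (hdisj a _ i ε ε' h1.symm h2).symm
    simp only [h, dif_pos hq]
    rw [hb, Fin.insertNth_removeNth, hH]
  have hh0 : ∀ i q, h star i q = 0 := by
    intro i q
    refine dif_neg ?_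
    rintro ⟨a, ha, -⟩
    exact hstar a ha
  have hψ : ∀ t v, ∑ i, ψ (i, i.removeNth (Fin.cons t v : Fin (e + 2) → α)) =
      g v + ∑ i, h t i (i.removeNth v) := by
    intro t v
    rw [Fin.sum_univ_succ]
    congr 1
    refine Finset.sum_congr rfl fun i _ => ?_
    have : i.succ.removeNth (Fin.cons t v : Fin (e + 2) → α) = Fin.cons t (i.removeNth v) := by
      rw [← Fin.cons_comp_succ_succAbove]; rfl
    simp [ψ, this]
  have hψ0 : ∀ v, ∑ i, ψ (i, i.removeNth (Fin.cons star v : Fin (e + 2) → α)) = g v := by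
    intro v
    rw [hψ, Finset.sum_eq_zero fun i _ => hh0 i _, add_zero]
  -- In the slice `star` all `h` vanish, so its points impose `g v = 0`; the other points are the
  -- corners of each cube in its own slice.
  let P : Set (Fin (e + 2) → α) := {p | (∃ v, g v = 0 ∧ p = Fin.cons star v) ∨
    ∃ a ε, p = Fin.cons (slice a) (corner (lo a) (hi a) ε)}
  refine ⟨P, ψ, ?_, fun v => Submodule.Quotient.mk (linesThrough (Fin.cons star v)), ?_, ?_, ?_⟩
  · rintro p (⟨v, hv, rfl⟩ | ⟨a, ε, rfl⟩)
    · rw [hψ0, hv]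
    · rw [hψ, hHg a ε]
      simp [hh]
  · intro v hv
    exact (Submodule.Quotient.mk_eq_zero _).2 (Submodule.subset_span ⟨_, Or.inl ⟨v, hv, rfl⟩, rfl⟩)
  · intro a
    have := map_alternatingSum (Submodule.mkQ (Submodule.span ℤ (linesThrough '' P))).toAddMonoidHom
      (lo a) (hi a) fun v => linesThrough (Fin.cons star v : Fin (e + 2) → α)
    refine this.symm.trans ?_
    rw [alternatingSum_linesThrough_cons star, ← alternatingSum_linesThrough_cons (slice a)]
    refine (Submodule.Quotient.mk_eq_zero _).2 (Submodule.sum_mem _ fun ε _ =>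
      Submodule.smul_mem _ _ (Submodule.subset_span ⟨_, Or.inr ⟨a, ε, rfl⟩, rfl⟩))
  · intro v
    refine ⟨_, rfl, ?_⟩
    rw [linesThrough, map_sum, ← hψ0 v]
    simp

end Cubes

/-! ### Addresses in base `n` -/

section Address

variable (n d : ℕ)

/-- The base `n` digits of `k`, as residues. -/
def address (k : ℕ) : Fin d → ZMod n := fun i => ((k / n ^ (i : ℕ) : ℕ) : ZMod n)

/-- The digits that change when `k` is increased by one. -/
def carry (k : ℕ) : Fin d → Bool := fun i => decide (n ^ (i : ℕ) ∣ k + 1)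

theorem address_succ (k : ℕ) (i : Fin d) :
    address n d (k + 1) i = address n d k i + if carry n d k i then 1 else 0 := by
  simp only [address, carry, Nat.succ_div, decide_eq_true_eq]
  split_ifs <;> simp

theorem address_injOn : Set.InjOn (address n d) {k | k < n ^ d} := by
  intro k hk k' hk' h
  have h1 : finFunctionFinEquiv.symm (⟨k, hk⟩ : Fin (n ^ d)) =
      finFunctionFinEquiv.symm (⟨k', hk'⟩ : Fin (n ^ d)) := by
    ext i
    have := congrFun h i
    rw [address, address, ZMod.natCast_eq_natCast_iff'] at this
    simpa using this
  simpa using finFunctionFinEquiv.symm.injective h1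

end Address

/-! ### Cells, and cubes with only four relevant corners -/

section Cells

variable {n j : ℕ} {G : Type*} [AddCommGroup G]

/-- Grid coordinates: a residue modulo `n` and a label. -/
abbrev Coord (n j : ℕ) : Type := ZMod n × Fin 8 × Option (Fin (j + 2) → Bool)

/-- The grid cell with address `a`, label `r` on the first axis, and label `c` on the others. -/
def cell (a : Fin (j + 2) → ZMod n) (r c : Fin 8) : Fin (j + 2) → Coord n j :=
  fun i => (a i, if i = 0 then r else c, none)

/-- The value of a function at a cell, up to a sign depending on the label `c`. -/
def signedValue (f : (Fin (j + 2) → Coord n j) → G) (a : Fin (j + 2) → ZMod n) (r c : Fin 8) : G :=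
  (-1 : ℤ) ^ ((j + 1) * (c : ℕ)) • f (cell a r c)

/-- Corners mixing `c` and `c'` on the axes other than the first contribute nothing. Changing those
`j + 1` axes together costs `(-1) ^ (j + 1)`, which `signedValue` absorbs because `c` is even and
`c'` odd. -/
theorem alternatingSum_cell {f : (Fin (j + 2) → Coord n j) → G}
    (hf : ∀ v, (∃ i i' : Fin (j + 1), (v i.succ).2 ≠ (v i'.succ).2) → f v = 0)
    (a a' : Fin (j + 2) → ZMod n) (r r' c c' : Fin 8) (hc : Even (c : ℕ)) (hc' : Odd (c' : ℕ)) :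
    alternatingSum (cell a r c) (cell a' r' c') f =
      signedValue f a r c - signedValue f (Fin.cons (a' 0) (Fin.tail a)) r' c +
      (signedValue f (Fin.cons (a 0) (Fin.tail a')) r c' - signedValue f a' r' c') := by
  have hcc : c ≠ c' := by rintro rfl; exact (Nat.not_even_iff_odd.2 hc') hc
  have hs : (-1 : ℤ) ^ ((j + 1) * (c : ℕ)) = 1 := (hc.mul_left _).neg_one_pow
  have hs' : (-1 : ℤ) ^ ((j + 1) * (c' : ℕ)) = (-1) ^ (j + 1) := by
    obtain ⟨t, ht⟩ := hc'
    rw [ht, mul_add, mul_one, pow_add, ← mul_assoc, mul_comm (j + 1) 2, mul_assoc, pow_mul]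
    simp
  have hne : (fun _ => false : Fin (j + 1) → Bool) ≠ fun _ => true :=
    fun h => by simpa using congrFun h 0
  have hrest : ∀ b : Bool, ∑ ε : Fin (j + 1) → Bool, cornerSign (Fin.cons b ε) •
      f (corner (cell a r c) (cell a' r' c') (Fin.cons b ε)) =
      cornerSign (Fin.cons b fun _ : Fin (j + 1) => false) •
        f (corner (cell a r c) (cell a' r' c') (Fin.cons b fun _ => false)) +
      cornerSign (Fin.cons b fun _ : Fin (j + 1) => true) •
        f (corner (cell a r c) (cell a' r' c') (Fin.cons b fun _ => true)) := by
    intro b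
    refine Fintype.sum_eq_add _ _ hne fun ε hε => ?_
    rw [hf, smul_zero]
    obtain ⟨i, hi⟩ := Function.ne_iff.1 hε.1
    obtain ⟨i', hi'⟩ := Function.ne_iff.1 hε.2
    refine ⟨i', i, ?_⟩
    simp only [ne_eq, Bool.not_eq_false, Bool.not_eq_true] at hi hi'
    simp [corner, cell, hi, hi', hcc]
  have hsum : alternatingSum (cell a r c) (cell a' r' c') f =
      ∑ b : Bool, ∑ ε : Fin (j + 1) → Bool, cornerSign (Fin.cons b ε) •
        f (corner (cell a r c) (cell a' r' c') (Fin.cons b ε)) := by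
    rw [alternatingSum, ← Fintype.sum_prod_type']
    exact (Fintype.sum_equiv (Fin.consEquiv fun _ => Bool) _ _ fun _ => rfl).symm
  have hcorner : ∀ b b' : Bool, corner (cell a r c) (cell a' r' c')
      (Fin.cons b fun _ => b' : Fin (j + 2) → Bool) =
      cell (Fin.cons (if b then a' 0 else a 0) (Fin.tail (if b' then a' else a)))
        (if b then r' else r) (if b' then c' else c) := by
    intro b b'
    funext i
    refine Fin.cases ?_ (fun i => ?_) i
    · cases b <;> simp [corner, cell]
    · cases b' <;> simp [corner, cell, Fin.tail]
  have hsign : ∀ b b' : Bool, cornerSign (Fin.cons b fun _ => b' : Fin (j + 2) → Bool) =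
      (if b then -1 else 1) * (if b' then (-1) ^ (j + 1) else 1) := by
    intro b b'
    rw [cornerSign, Fin.prod_univ_succ]
    cases b' <;> simp
  have hcons : ∀ a : Fin (j + 2) → ZMod n, (Fin.cons (a 0) (Fin.tail a) : Fin (j + 2) → ZMod n) = a :=
    Fin.cons_self_tail
  rw [hsum, Fintype.sum_bool, hrest, hrest]
  simp only [hcorner, hsign, signedValue, hs, hs', if_true, Bool.false_eq_true, if_false, hcons,
    one_mul, mul_one, neg_mul, neg_smul, one_smul]
  abel

/-- The function on the grid given by a table of register values. -/
noncomputable def tableFunction (dec : (Fin (j + 2) → ZMod n) → ℕ) (V : ℕ → Fin 8 → Fin 8 → G)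
    (v : Fin (j + 2) → Coord n j) : G :=
  open Classical in
  if v = cell (fun i => (v i).1) (v 0).2.1 (v 1).2.1 then
    (-1 : ℤ) ^ ((j + 1) * ((v 1).2.1 : ℕ)) • V (dec fun i => (v i).1) (v 0).2.1 (v 1).2.1
  else 0

theorem tableFunction_cell (dec : (Fin (j + 2) → ZMod n) → ℕ) (V : ℕ → Fin 8 → Fin 8 → G)
    (a : Fin (j + 2) → ZMod n) (r c : Fin 8) :
    tableFunction dec V (cell a r c) = (-1 : ℤ) ^ ((j + 1) * (c : ℕ)) • V (dec a) r c := by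
  have h1 : (1 : Fin (j + 2)) ≠ 0 := by simp
  have h : cell a r c = cell (fun i => (cell a r c i).1) (cell a r c 0).2.1 (cell a r c 1).2.1 := by
    simp [cell]
  rw [tableFunction, if_pos h]
  simp [cell]

theorem signedValue_tableFunction (dec : (Fin (j + 2) → ZMod n) → ℕ) (V : ℕ → Fin 8 → Fin 8 → G)
    (a : Fin (j + 2) → ZMod n) (r c : Fin 8) :
    signedValue (tableFunction dec V) a r c = V (dec a) r c := by
  rw [signedValue, tableFunction_cell, smul_smul, ← mul_pow]
  simp

theorem tableFunction_eq_zero (dec : (Fin (j + 2) → ZMod n) → ℕ) (V : ℕ → Fin 8 → Fin 8 → G)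
    (v : Fin (j + 2) → Coord n j) (hv : ∃ i i' : Fin (j + 1), (v i.succ).2 ≠ (v i'.succ).2) :
    tableFunction dec V v = 0 := by
  obtain ⟨i, i', h⟩ := hv
  refine if_neg fun hv => h ?_
  rw [hv]
  simp [cell]

end Cells

/-! ### Cube kinds and their packing into slices -/

section Program

/-- The labels of the two opposite corners of a cube, and the shift between their addresses. -/
structure CubeKind where
  r : Fin 8
  c : Fin 8
  r' : Fin 8
  c' : Fin 8
  shift : ℕ

/-- The kinds of cubes: copies of registers, addition of registers, and links from the registers
at address `k` to those at address `k + 1`. -/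
def cubeKind : Fin 8 → CubeKind
  -- A cube joins an even label to an odd one and changes both labels; hence the detours through the
  -- copies `(2, 3)` and `(3, 3)`. Kind `4` adds, because its mixed cell `(4, 1)` is a register.
  | 0 => ⟨1, 2, 2, 3, 0⟩
  | 1 => ⟨4, 0, 2, 3, 0⟩
  | 2 => ⟨1, 2, 4, 1, 0⟩
  | 3 => ⟨0, 2, 4, 1, 0⟩
  | 4 => ⟨4, 0, 5, 1, 0⟩
  | 5 => ⟨0, 2, 3, 3, 0⟩
  | 6 => ⟨0, 2, 3, 3, 1⟩
  | 7 => ⟨1, 2, 5, 1, 1⟩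

theorem cubeKind_r_ne (κ : Fin 8) : (cubeKind κ).r ≠ (cubeKind κ).r' := by
  revert κ; decide

theorem cubeKind_even (κ : Fin 8) : Even ((cubeKind κ).c : ℕ) := by
  revert κ; decide

theorem cubeKind_odd (κ : Fin 8) : Odd ((cubeKind κ).c' : ℕ) := by
  revert κ; decide

theorem cubeKind_c_ne (κ : Fin 8) : (cubeKind κ).c ≠ (cubeKind κ).c' := by
  revert κ; decide

theorem cubeKind_shift (κ : Fin 8) : (cubeKind κ).shift = 0 ∨ (cubeKind κ).shift = 1 := by
  revert κ; decide

variable {n j : ℕ}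

/-- The corner of the cube of kind `κ` at `k` with the even label. -/
def cubeLo (p : Fin 8 × ℕ) : Fin (j + 2) → Coord n j :=
  cell (address n (j + 2) (p.2 + (cubeKind p.1).shift)) (cubeKind p.1).r (cubeKind p.1).c

/-- The corner of the cube of kind `κ` at `k` with the odd label. -/
def cubeHi (p : Fin 8 × ℕ) : Fin (j + 2) → Coord n j :=
  cell (address n (j + 2) p.2) (cubeKind p.1).r' (cubeKind p.1).c'

/-- The slice that contains the cube of kind `κ` at `k`. -/
def cubeSlice (p : Fin 8 × ℕ) : Coord n j :=
  (∑ i, address n (j + 2) p.2 i, p.1, some (carry n (j + 2) p.2))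

/-- Off `i`, labels reveal whether a coordinate comes from `cubeLo` or `cubeHi`, and equal carry
patterns undo the shift, so the digits agree. The common digit sum then determines digit `i`. -/
theorem eq_of_cubeSlice_eq {p q : Fin 8 × ℕ} (hp : p.2 < n ^ (j + 2)) (hq : q.2 < n ^ (j + 2))
    {i : Fin (j + 2)} {ε ε' : Fin (j + 2) → Bool}
    (hslice : (cubeSlice p : Coord n j) = cubeSlice q)
    (h : i.removeNth (corner (cubeLo p : Fin (j + 2) → Coord n j) (cubeHi p) ε) =
      i.removeNth (corner (cubeLo q) (cubeHi q) ε')) : p = q := by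
  obtain ⟨κ, k⟩ := p
  obtain ⟨κ', k'⟩ := q
  simp only [cubeSlice, Prod.mk.injEq, Option.some.injEq] at hslice
  obtain ⟨hsum, rfl, hcarry⟩ := hslice
  have hoff : ∀ l, l ≠ i → address n (j + 2) k l = address n (j + 2) k' l := by
    intro l hli
    obtain ⟨m, rfl⟩ := Fin.exists_succAbove_eq hli
    have hm := congrFun h m
    simp only [Fin.removeNth_apply, corner, cubeLo, cubeHi, cell] at hm
    have hr := cubeKind_r_ne κ
    have hc := cubeKind_c_ne κ
    have hlab : (if i.succAbove m = 0 then (cubeKind κ).r else (cubeKind κ).c) ≠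
        if i.succAbove m = 0 then (cubeKind κ).r' else (cubeKind κ).c' := by
      split_ifs <;> assumption
    have hsucc : address n (j + 2) (k + (cubeKind κ).shift) (i.succAbove m) =
        address n (j + 2) (k' + (cubeKind κ).shift) (i.succAbove m) →
        address n (j + 2) k (i.succAbove m) = address n (j + 2) k' (i.succAbove m) := by
      rcases cubeKind_shift κ with h0 | h1
      · simp [h0]
      · rw [h1, address_succ, address_succ, hcarry]
        exact add_right_cancel
    cases hε : ε (i.succAbove m) <;> cases hε' : ε' (i.succAbove m) <;>
      simp only [hε, hε', if_true, Bool.false_eq_true, if_false, Prod.mk.injEq] at hm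
    · exact hsucc hm.1
    · exact absurd hm.2.1 hlab
    · exact absurd hm.2.1.symm hlab
    · exact hm.1
  have hi : address n (j + 2) k i = address n (j + 2) k' i := by
    rw [← Finset.add_sum_erase _ _ (Finset.mem_univ i),
      ← Finset.add_sum_erase _ (address n (j + 2) k') (Finset.mem_univ i),
      Finset.sum_congr rfl fun l hl => hoff l (Finset.ne_of_mem_erase hl)] at hsum
    exact add_right_cancel hsum
  have : address n (j + 2) k = address n (j + 2) k' := by
    funext l
    by_cases hl : l = i
    · rw [hl, hi]
    · exact hoff l hl
  exact congrArg (Prod.mk κ) (address_injOn n (j + 2) hp hq this)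

end Program

/-! ### Registers and the relations between them -/

section Program

variable {G : Type*} [AddCommGroup G]

/-- The multiple of the unit that is added to the accumulator: the accumulator itself, for
doubling, or one unit. -/
def increment (m : ℕ → ℕ) (sel : ℕ → Bool) (k : ℕ) : ℕ := if sel k then m k else 1

/-- The registers at address `k`: the unit `x k`, the accumulator `m k • x k`, copies of both, and
the next value of the accumulator. -/
def registers (x : ℕ → G) (m : ℕ → ℕ) (sel : ℕ → Bool) (k : ℕ) : Fin 8 → Fin 8 → G
  | 0, 2 => x k
  | 1, 2 => m k • x k
  | 2, 3 => m k • x k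
  | 3, 3 => x k
  | 4, 0 => m k • x k
  | 4, 1 => increment m sel k • x k
  | 5, 1 => (m k + increment m sel k) • x k
  | _, _ => 0

/-- The cubes whose relation holds for the registers. -/
def validCube (n j : ℕ) (x : ℕ → G) (m : ℕ → ℕ) (sel : ℕ → Bool) (p : Fin 8 × ℕ) : Prop :=
  p.2 < n ^ (j + 2) ∧ (p.1 = 2 → sel p.2 = true) ∧ (p.1 = 3 → sel p.2 = false) ∧
    ((cubeKind p.1).shift = 1 → p.2 + 1 < n ^ (j + 2) ∧ x (p.2 + 1) = x p.2 ∧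
      m (p.2 + 1) = m p.2 + increment m sel p.2)

variable {n j : ℕ} (x : ℕ → G) (m : ℕ → ℕ) (sel : ℕ → Bool)

/-- The decoding of addresses. -/
noncomputable def decode (n j : ℕ) : (Fin (j + 2) → ZMod n) → ℕ :=
  Function.invFunOn (address n (j + 2)) {k | k < n ^ (j + 2)}

theorem decode_address {k : ℕ} (hk : k < n ^ (j + 2)) : decode n j (address n (j + 2) k) = k :=
  (address_injOn n (j + 2)).leftInvOn_invFunOn hk

/-- The function on the grid with values in the registers. -/
noncomputable def registerFunction (n j : ℕ) : (Fin (j + 2) → Coord n j) → G :=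
  tableFunction (decode n j) (registers x m sel)

theorem signedValue_registerFunction {k : ℕ} (hk : k < n ^ (j + 2)) (r c : Fin 8) :
    signedValue (registerFunction x m sel n j) (address n (j + 2) k) r c =
      registers x m sel k r c := by
  rw [registerFunction, signedValue_tableFunction, decode_address hk]

theorem signedValue_two (f : (Fin (j + 2) → Coord n j) → G) (a : Fin (j + 2) → ZMod n)
    (r : Fin 8) : signedValue f a r 2 = f (cell a r 2) := by
  rw [signedValue, Even.neg_one_pow (Even.mul_left (by decide) _), one_smul]

section Relations

variable {x m sel} {A : Type*} [AddCommGroup A] {E : (Fin (j + 2) → Coord n j) → A}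
  (hE : ∀ v, registerFunction x m sel n j v = 0 → E v = 0)

include hE

theorem signedValue_eq_zero {a : Fin (j + 2) → ZMod n} {r c : Fin 8}
    (h : registers x m sel (decode n j a) r c = 0) : signedValue E a r c = 0 := by
  rw [signedValue, hE, smul_zero]
  rw [registerFunction, tableFunction_cell, h, smul_zero]

/-- Of the four surviving corners, the two mixed ones hold no register, except `(4, 1)` in kind `4`.
-/
theorem alternatingSum_cube (p : Fin 8 × ℕ) :
    alternatingSum (cubeLo p) (cubeHi p) E =
      signedValue E (address n (j + 2) (p.2 + (cubeKind p.1).shift))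
        (cubeKind p.1).r (cubeKind p.1).c +
      (if p.1 = 4 then signedValue E (address n (j + 2) p.2) 4 1 else 0) -
      signedValue E (address n (j + 2) p.2) (cubeKind p.1).r' (cubeKind p.1).c' := by
  obtain ⟨κ, k⟩ := p
  rw [cubeLo, cubeHi, alternatingSum_cell _ _ _ _ _ _ _ (cubeKind_even κ) (cubeKind_odd κ)]
  · have h1 : ∀ a : Fin (j + 2) → ZMod n,
        signedValue E a (cubeKind κ).r' (cubeKind κ).c = 0 := by
      intro a
      refine signedValue_eq_zero hE ?_
      fin_cases κ <;> rfl
    have h2 : ∀ a : Fin (j + 2) → ZMod n, κ ≠ 4 →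
        signedValue E a (cubeKind κ).r (cubeKind κ).c' = 0 := by
      intro a h
      refine signedValue_eq_zero hE ?_
      fin_cases κ <;> first | rfl | exact absurd rfl h
    rw [h1]
    by_cases h : κ = 4
    · subst h
      have hcons : (Fin.cons (address n (j + 2) k 0) (Fin.tail (address n (j + 2) k)) :
          Fin (j + 2) → ZMod n) = address n (j + 2) k := Fin.cons_self_tail _
      simp only [cubeKind, add_zero, hcons, if_true]
      abel
    · rw [h2 _ h, if_neg h]
      abel
  · exact fun v hv => hE v (tableFunction_eq_zero _ _ v hv)

end Relations

theorem alternatingSum_registerFunction {p : Fin 8 × ℕ} (hp : validCube n j x m sel p) :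
    alternatingSum (cubeLo p) (cubeHi p) (registerFunction x m sel n j) = 0 := by
  rw [alternatingSum_cube (fun _ h => h)]
  obtain ⟨κ, k⟩ := p
  obtain ⟨hk, h2, h3, h1⟩ := hp
  dsimp only at hk h2 h3 h1 ⊢
  have hk' : k + (cubeKind κ).shift < n ^ (j + 2) := by
    rcases cubeKind_shift κ with h | h
    · rwa [h]
    · rw [h]; exact (h1 h).1
  simp only [signedValue_registerFunction x m sel hk, signedValue_registerFunction x m sel hk']
  fin_cases κ
  · exact sub_eq_zero.2 (add_zero _)
  · exact sub_eq_zero.2 (add_zero _)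
  · have := h2 rfl
    simp [cubeKind, registers, increment, this]
  · have := h3 rfl
    simp [cubeKind, registers, increment, this]
  · simp [cubeKind, registers, add_smul]
  · exact sub_eq_zero.2 (add_zero _)
  · have := h1 rfl
    simp [cubeKind, registers, this]
  · have := h1 rfl
    simp [cubeKind, registers, this]

/-- The program is replayed in an arbitrary group `A`, using only the cube relations and the
vanishing of empty cells; a reset restarts the induction at `0`. -/
theorem accumulator_eq (hm0 : m 0 = 0)
    (hstep : ∀ k, m (k + 1) = 0 ∨ (x (k + 1) = x k ∧ m (k + 1) = m k + increment m sel k))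
    {A : Type*} [AddCommGroup A] {E : (Fin (j + 2) → Coord n j) → A}
    (hE : ∀ v, registerFunction x m sel n j v = 0 → E v = 0)
    (hcube : ∀ p, validCube n j x m sel p → alternatingSum (cubeLo p) (cubeHi p) E = 0)
    {k : ℕ} (hk : k < n ^ (j + 2)) :
    signedValue E (address n (j + 2) k) 1 2 = m k • signedValue E (address n (j + 2) k) 0 2 := by
  have hzero : ∀ k < n ^ (j + 2), m k = 0 →
      signedValue E (address n (j + 2) k) 1 2 =
        m k • signedValue E (address n (j + 2) k) 0 2 := by
    intro k hk hmk
    rw [hmk, zero_smul]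
    refine signedValue_eq_zero hE ?_
    rw [decode_address hk]
    simp [registers, hmk]
  induction k with
  | zero => exact hzero 0 hk hm0
  | succ k ih =>
    rcases hstep k with h0 | ⟨hx, hm⟩
    · exact hzero _ hk h0
    have hk' : k < n ^ (j + 2) := by omega
    have ih := ih hk'
    have rel : ∀ κ, (κ = 2 → sel k = true) → (κ = 3 → sel k = false) →
        signedValue E (address n (j + 2) (k + (cubeKind κ).shift)) (cubeKind κ).r (cubeKind κ).c +
          (if κ = 4 then signedValue E (address n (j + 2) k) 4 1 else 0) =
          signedValue E (address n (j + 2) k) (cubeKind κ).r' (cubeKind κ).c' := by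
      intro κ h2 h3
      rw [← sub_eq_zero, ← alternatingSum_cube hE (κ, k)]
      exact hcube _ ⟨hk', h2, h3, fun _ => ⟨hk, hx, hm⟩⟩
    have r0 := rel 0 (by simp) (by simp)
    have r1 := rel 1 (by simp) (by simp)
    have r4 := rel 4 (by simp) (by simp)
    have r5 := rel 5 (by simp) (by simp)
    have r6 := rel 6 (by simp) (by simp)
    have r7 := rel 7 (by simp) (by simp)
    have rb : signedValue E (address n (j + 2) k) 4 1 =
        increment m sel k • signedValue E (address n (j + 2) k) 0 2 := by
      by_cases hs : sel k = true
      · have r2 := rel 2 (fun _ => hs) (by simp)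
        simp only [cubeKind, add_zero, Fin.reduceEq, if_false] at r2
        rw [← r2, ih, increment, if_pos hs]
      · have r3 := rel 3 (by simp) (fun _ => by simpa using hs)
        simp only [cubeKind, add_zero, Fin.reduceEq, if_false] at r3
        rw [← r3, increment, if_neg hs, one_smul]
    simp only [cubeKind, add_zero, Fin.reduceEq, if_false, if_true] at r0 r1 r4 r5 r6 r7
    -- Kinds `7` and `4` write the new accumulator as `(4, 0)` plus `(4, 1)`, kinds `1` and `0`
    -- identify `(4, 0)` with the old accumulator, and kinds `6` and `5` identify the two units.
    rw [r7, ← r4, r1, ← r0, ih, rb, r6, ← r5, hm, add_smul]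

/-- A program of `n ^ d` doublings and unit additions, with resets, which verifies that multiples of
the elements of a generating set vanish, gives a complex on `O(n)` vertices. -/
theorem exists_isQAcyclic_of_program [NeZero n] (hm0 : m 0 = 0)
    (hstep : ∀ k, m (k + 1) = 0 ∨ (x (k + 1) = x k ∧ m (k + 1) = m k + increment m sel k))
    (hgen : AddSubgroup.closure {g | ∃ k < n ^ (j + 2), x k = g ∧ m k ≠ 0 ∧ m k • g = 0} = ⊤) :
    ∃ X : AbstractSimplicialComplex (Fin ((j + 3) * Fintype.card (Coord n j))),
      IsQAcyclic X (j + 2) ∧ ∃ f : G →+ Homology X (j + 1), Function.Injective f := by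
  obtain ⟨P, ψ, hψ, E, hE0, hEcube, hEval⟩ := exists_lines_of_cubes
    (ι := {p // validCube n j x m sel p}) (registerFunction x m sel n j)
    ((0, 0, none) : Coord n j) (fun p => cubeLo p.1) (fun p => cubeHi p.1)
    (fun p => cubeSlice p.1) (by simp [cubeSlice])
    (fun p q i ε ε' hs h => Subtype.ext (eq_of_cubeSlice_eq p.2.1 q.2.1 hs h))
    (fun p => alternatingSum_registerFunction x m sel p.2)
  refine exists_isQAcyclic_of_grid P ψ hψ fun g => ?_
  have hg : g ∈ AddSubgroup.closure {g | ∃ k < n ^ (j + 2), x k = g ∧ m k ≠ 0 ∧ m k • g = 0} := by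
    rw [hgen]; trivial
  induction hg using AddSubgroup.closure_induction with
  | mem g hg =>
    obtain ⟨k, hk, rfl, hmk, hmx⟩ := hg
    obtain ⟨z, hz, hzx⟩ := hEval (cell (address n (j + 2) k) 0 2)
    refine ⟨z, ?_, m k, by exact_mod_cast hmk, ?_⟩
    · rw [hzx, ← signedValue_two (registerFunction x m sel n j), signedValue_registerFunction x m sel hk]
      rfl
    -- `m k • E(unit)` is `E` at the accumulator cell, whose register value `m k • x k` is zero in
    -- `G`.
    · rw [← Submodule.Quotient.mk_eq_zero, Submodule.Quotient.mk_smul, hz, ← signedValue_two E, natCast_zsmul,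
        ← accumulator_eq x m sel hm0 hstep hE0 (fun p hp => hEcube ⟨p, hp⟩) hk]
      refine signedValue_eq_zero hE0 ?_
      rw [decode_address hk]
      exact hmx
  | zero => exact ⟨0, map_zero _, 1, one_ne_zero, by simp⟩
  | add g h _ _ hg hh =>
    obtain ⟨y, rfl, a, ha, hay⟩ := hg
    obtain ⟨z, rfl, b, hb, hbz⟩ := hh
    refine ⟨y + z, map_add _ _ _, a * b, mul_ne_zero ha hb, ?_⟩
    rw [smul_add, mul_comm a b, mul_smul, mul_comm b a, mul_smul]
    exact Submodule.add_mem _ (Submodule.smul_mem _ _ hay) (Submodule.smul_mem _ _ hbz)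
  | neg g _ hg =>
    obtain ⟨y, rfl, a, ha, hay⟩ := hg
    exact ⟨-y, map_neg _ _, a, ha, by rw [smul_neg]; exact Submodule.neg_mem _ hay⟩

end Program

/-! ### Double-and-add programs -/

section ListProgram

variable {G : Type*}

/-- A state of a program: the unit, the multiple of it in the accumulator, and whether the
accumulator is doubled next. -/
abbrev ProgramState (G : Type*) : Type _ := G × ℕ × Bool

/-- Admissible transitions: a doubling, an addition of the unit, or a reset. -/
def ProgramStep (s t : ProgramState G) : Prop :=
  t.2.1 = 0 ∨ (t.1 = s.1 ∧ t.2.1 = s.2.1 + if s.2.2 then s.2.1 else 1)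

/-- A list of states with admissible transitions that starts with an empty accumulator. -/
def IsProgram (l : List (ProgramState G)) : Prop :=
  l.IsChain ProgramStep ∧ ∀ s ∈ l.head?, s.2.1 = 0

theorem IsProgram.append {l₁ l₂ : List (ProgramState G)} (h₁ : IsProgram l₁) (h₂ : IsProgram l₂) :
    IsProgram (l₁ ++ l₂) := by
  refine ⟨List.isChain_append.2 ⟨h₁.1, h₂.1, fun s _ t ht => Or.inl (h₂.2 t ht)⟩, ?_⟩
  cases l₁ with
  | nil => exact h₂.2
  | cons a l => exact h₁.2

theorem IsProgram.concat {l : List (ProgramState G)} {s t : ProgramState G}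
    (h : IsProgram (l ++ [s])) (hst : ProgramStep s t) : IsProgram (l ++ [s] ++ [t]) := by
  refine ⟨List.isChain_append.2 ⟨h.1, by simp, ?_⟩, ?_⟩
  · simpa using hst
  · cases l with
    | nil => exact h.2
    | cons a l => exact h.2

/-- The multiple `N` of a unit is computed in at most `2 * Nat.size N + 1` steps. -/
theorem exists_isProgram_concat (x : G) (N : ℕ) :
    ∃ l : List (ProgramState G), l.length ≤ 2 * N.size ∧ ∀ b, IsProgram (l ++ [(x, N, b)]) := by
  induction N using Nat.binaryRec' with
  | zero => exact ⟨[], by simp, fun b => ⟨by simp, by simp⟩⟩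
  | bit b N hb ih =>
    obtain ⟨l, hl, h⟩ := ih
    have hsize : (Nat.bit b N).size = N.size + 1 := Nat.size_bit (by
      cases N with
      | zero => simp [hb rfl]
      | succ N => cases b <;> simp [Nat.bit])
    have h2 : ∀ b', IsProgram (l ++ [(x, N, true)] ++ [(x, 2 * N, b')]) := fun b' =>
      (h true).concat (Or.inr ⟨rfl, by simp [two_mul]⟩)
    cases b with
    | false =>
      exact ⟨l ++ [(x, N, true)], by rw [List.length_append, hsize]; simp; omega, h2⟩
    | true =>
      refine ⟨l ++ [(x, N, true)] ++ [(x, 2 * N, false)], by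
        rw [List.length_append, List.length_append, hsize]; simp; omega, fun b' => ?_⟩
      exact (h2 false).concat (Or.inr ⟨rfl, by simp [Nat.bit]⟩)

/-- Units `x i` and multiples `N i` are computed one after the other. -/
theorem exists_isProgram_of_list {ι : Type*} (x : ι → G) (N : ι → ℕ) (is : List ι) :
    ∃ l : List (ProgramState G), IsProgram l ∧
      l.length ≤ (is.map fun i => 2 * (N i).size + 1).sum ∧
      ∀ i ∈ is, ∃ b, (x i, N i, b) ∈ l := by
  induction is with
  | nil => exact ⟨[], ⟨by simp, by simp⟩, by simp, by simp⟩
  | cons i is ih =>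
    obtain ⟨l, hl, hlen, hmem⟩ := ih
    obtain ⟨l', hlen', hl'⟩ := exists_isProgram_concat (x i) (N i)
    refine ⟨(l' ++ [(x i, N i, true)]) ++ l, (hl' true).append hl, ?_, ?_⟩
    · simp only [List.length_append, List.length_singleton, List.map_cons, List.sum_cons]
      omega
    · rintro k hk
      rcases List.mem_cons.1 hk with rfl | hk
      · exact ⟨true, by simp⟩
      · obtain ⟨b, hb⟩ := hmem k hk
        exact ⟨b, List.mem_append_right _ hb⟩

theorem IsProgram.getD_step [Zero G] {l : List (ProgramState G)} (h : IsProgram l) (k : ℕ) :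
    ProgramStep (l.getD k (0, 0, false)) (l.getD (k + 1) (0, 0, false)) := by
  by_cases hk : k + 1 < l.length
  · rw [List.getD_eq_getElem _ _ hk, List.getD_eq_getElem _ _ (by omega)]
    exact List.isChain_iff_getElem.1 h.1 k hk
  -- Past the end, the default state has an empty accumulator and counts as a reset.
  · rw [List.getD_eq_default _ _ (by omega : l.length ≤ k + 1)]
    exact Or.inl rfl

theorem IsProgram.getD_zero [Zero G] {l : List (ProgramState G)} (h : IsProgram l) :
    (l.getD 0 (0, 0, false)).2.1 = 0 := by
  cases l with
  | nil => rfl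
  | cons a l => exact h.2 a rfl

end ListProgram

/-! ### Program length and the vertex count -/

theorem size_le_log {N : ℕ} (hN : 1 < N) :
    ((2 * N.size + 1 : ℕ) : ℝ) ≤ 5 / Real.log 2 * Real.log N := by
  have h2 : 0 < Real.log 2 := Real.log_pos one_lt_two
  have h1 : N.size ≤ Nat.log 2 N + 1 := Nat.size_le.2 (Nat.lt_pow_succ_log_self one_lt_two N)
  have h3 : 1 ≤ Nat.log 2 N := Nat.log_pos one_lt_two hN
  have h4 : (Nat.log 2 N : ℝ) * Real.log 2 ≤ Real.log N := by
    rw [← Real.log_pow]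
    refine Real.log_le_log (by positivity) ?_
    exact_mod_cast Nat.pow_log_le_self 2 (by omega)
  have h5 : ((2 * N.size + 1 : ℕ) : ℝ) ≤ 5 * (Nat.log 2 N : ℝ) := by
    -- The size is at most `Nat.log 2 N + 1`, and `1 ≤ Nat.log 2 N`.
    have : 2 * N.size + 1 ≤ 5 * Nat.log 2 N := by omega
    exact_mod_cast this
  calc ((2 * N.size + 1 : ℕ) : ℝ) ≤ 5 * (Nat.log 2 N : ℝ) := h5
    _ = 5 / Real.log 2 * (Nat.log 2 N * Real.log 2) := by field_simp
    _ ≤ _ := by gcongr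

/-- A finite abelian group is generated by elements whose orders are verified by a program of
logarithmic length. -/
theorem exists_isProgram_of_finite (G : Type*) [AddCommGroup G] [Finite G] :
    ∃ l : List (ProgramState G), IsProgram l ∧
      (l.length : ℝ) ≤ 5 / Real.log 2 * Real.log (Nat.card G) ∧
      AddSubgroup.closure {g | ∃ s ∈ l, s.1 = g ∧ s.2.1 ≠ 0 ∧ s.2.1 • g = 0} = ⊤ := by
  classical
  obtain ⟨ι, _, N, hN, ⟨e⟩⟩ := AddCommGroup.equiv_directSum_zmod_of_finite' G
  let x (i : ι) : G := e.symm (DirectSum.of (fun i => ZMod (N i)) i 1)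
  obtain ⟨l, hl, hlen, hmem⟩ := exists_isProgram_of_list x N Finset.univ.toList
  refine ⟨l, hl, ?_, ?_⟩
  · have hcard : Nat.card G = ∏ i, N i := by
      rw [Nat.card_congr (e.toEquiv.trans DFinsupp.equivFunOnFintype), Nat.card_pi]
      simp
    rw [hcard, Nat.cast_prod, Real.log_prod fun i _ => by
      have := hN i
      positivity, Finset.mul_sum]
    rw [Finset.sum_map_toList] at hlen
    calc (l.length : ℝ) ≤ ((∑ i, (2 * (N i).size + 1) : ℕ) : ℝ) := by exact_mod_cast hlen
      _ = ∑ i, ((2 * (N i).size + 1 : ℕ) : ℝ) := by push_cast; rfl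
      _ ≤ _ := Finset.sum_le_sum fun i _ => size_le_log (hN i)
  · refine (AddSubgroup.eq_top_iff' _).2 fun g => ?_
    have hx : ∀ i, x i ∈ AddSubgroup.closure
        {g | ∃ s ∈ l, s.1 = g ∧ s.2.1 ≠ 0 ∧ s.2.1 • g = 0} := by
      intro i
      obtain ⟨b, hb⟩ := hmem i (by simp)
      refine AddSubgroup.subset_closure ⟨_, hb, rfl, (zero_lt_one.trans (hN i)).ne', ?_⟩
      simp only [x]
      rw [← map_nsmul, ← map_nsmul]
      simp
    obtain ⟨y, rfl⟩ := e.symm.surjective g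
    induction y using DirectSum.induction_on with
    | zero => rw [map_zero]; exact AddSubgroup.zero_mem _
    | of i a =>
      have : e.symm (DirectSum.of (fun i => ZMod (N i)) i a) = (a.cast : ℤ) • x i := by
        simp only [x]
        rw [← map_zsmul, ← map_zsmul]
        simp
      rw [this]
      exact AddSubgroup.zsmul_mem _ (hx i) _
    | add y z hy hz => rw [map_add]; exact AddSubgroup.add_mem _ hy hz

theorem card_coord (n j : ℕ) [NeZero n] :
    Fintype.card (Coord n j) = n * (8 * (2 ^ (j + 2) + 1)) := by
  simp [ZMod.card]

theorem exists_isQAcyclic_of_pow_ge {G : Type*} [AddCommGroup G] {n j : ℕ} [NeZero n]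
    {l : List (ProgramState G)} (hl : IsProgram l) (hn : l.length ≤ n ^ (j + 2))
    (hgen : AddSubgroup.closure {g | ∃ s ∈ l, s.1 = g ∧ s.2.1 ≠ 0 ∧ s.2.1 • g = 0} = ⊤) :
    ∃ X : AbstractSimplicialComplex (Fin ((j + 3) * Fintype.card (Coord n j))),
      IsQAcyclic X (j + 2) ∧ ∃ f : G →+ Homology X (j + 1), Function.Injective f := by
  refine exists_isQAcyclic_of_program (fun k => (l.getD k (0, 0, false)).1)
    (fun k => (l.getD k (0, 0, false)).2.1) (fun k => (l.getD k (0, 0, false)).2.2)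
    hl.getD_zero hl.getD_step ?_
  rw [eq_top_iff, ← hgen]
  refine AddSubgroup.closure_mono ?_
  rintro g ⟨s, hs, rfl, h0, h1⟩
  obtain ⟨k, hk, rfl⟩ := List.getElem_of_mem hs
  refine ⟨k, hk.trans_le hn, ?_⟩
  simp only [List.getD_eq_getElem _ _ hk]
  exact ⟨trivial, h0, h1⟩

end SimplicialHomology

theorem mainTheorem9 (d : ℕ) (hd : 2 ≤ d) :
    ∃ C : ℝ, ∀ (G : Type*) [AddCommGroup G] [Finite G] [Nontrivial G],
      ∃ (n : ℕ) (X : AbstractSimplicialComplex (Fin n)),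
        SimplicialHomology.IsQAcyclic X d ∧
        (n : ℝ) ≤ C * Real.log (Nat.card G : ℝ) ^ (1 / (d : ℝ)) ∧
        ∃ f : G →+ SimplicialHomology.Homology X (d - 1), Function.Injective f := by
  obtain ⟨j, rfl⟩ := Nat.exists_eq_add_of_le' hd
  have h2 : 0 < Real.log 2 := Real.log_pos one_lt_two
  -- The first factor is the number of vertices per unit of `n`; `2` pays for rounding `r ≥ 1` up to
  -- `n = ⌈r⌉₊`, and `5 / log 2` is the program length per unit of `log |G|`.
  refine ⟨((j + 3) * (8 * (2 ^ (j + 2) + 1)) : ℕ) * (2 * (5 / Real.log 2) ^ (1 / ((j + 2 : ℕ) : ℝ))),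
    fun G _ _ _ => ?_⟩
  obtain ⟨l, hl, hlen, hgen⟩ := SimplicialHomology.exists_isProgram_of_finite G
  set K : ℝ := 5 / Real.log 2 * Real.log (Nat.card G) with hK
  set r : ℝ := K ^ (1 / ((j + 2 : ℕ) : ℝ)) with hr
  have hcard : (2 : ℝ) ≤ Nat.card G := by exact_mod_cast Finite.one_lt_card (α := G)
  have hlog : Real.log 2 ≤ Real.log (Nat.card G) := Real.log_le_log two_pos hcard
  have hK1 : 1 ≤ K := by
    rw [hK, div_mul_eq_mul_div, le_div_iff₀ h2]
    linarith
  have hr1 : 1 ≤ r := Real.one_le_rpow hK1 (by positivity)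
  have hrK : r ^ (j + 2) = K := by
    rw [hr, one_div]
    exact Real.rpow_inv_natCast_pow (by linarith) (by omega)
  have hn0 : ⌈r⌉₊ ≠ 0 := (Nat.ceil_pos.2 (by linarith)).ne'
  have : NeZero ⌈r⌉₊ := ⟨hn0⟩
  have hn : l.length ≤ ⌈r⌉₊ ^ (j + 2) := by
    have h : (l.length : ℝ) ≤ (⌈r⌉₊ : ℝ) ^ (j + 2) :=
      hlen.trans (hrK ▸ pow_le_pow_left₀ (by linarith) (Nat.le_ceil r) _)
    exact_mod_cast h
  obtain ⟨X, hX, f, hf⟩ := SimplicialHomology.exists_isQAcyclic_of_pow_ge (j := j) hl hn hgen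
  refine ⟨_, X, hX, ?_, f, hf⟩
  have hceil : (⌈r⌉₊ : ℝ) ≤ 2 * r := by
    have := (Nat.ceil_lt_add_one (by linarith : 0 ≤ r)).le
    linarith
  have hsplit : r = (5 / Real.log 2) ^ (1 / ((j + 2 : ℕ) : ℝ)) *
      Real.log (Nat.card G) ^ (1 / ((j + 2 : ℕ) : ℝ)) :=
    Real.mul_rpow (by positivity) (by linarith)
  rw [SimplicialHomology.card_coord, ← mul_assoc, mul_comm _ ⌈r⌉₊, mul_assoc, Nat.cast_mul,
    mul_assoc _ (2 * _), mul_assoc 2, ← hsplit, mul_comm]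
  gcongr
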